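/- Let $1\le p\le\infty$, let $d$ be the $l_p$ metric on $\mathbb R^2$, and let $S=\{s_1,\dots,s_n\}$ be a finite family of closed line segments in the plane (a segment may be a single point). For points $v_1,v_2$ and $1\le\beta<\infty$, a *lens* of $v_1,v_2$ is an intersection of two $l_p$ discs of radius $\beta d(v_1,v_2)/2$ with centres $c_1,c_2$ such that $d(c_1,c_2)=(\beta-1)d(v_1,v_2)$ and $d(v_1,c_2)=d(v_2,c_1)=|(\beta-2)d(v_1,v_2)/2|$. (For $1<p<\infty$ the centres are unique: $c_1=(1-\frac\beta2)v_1+\frac\beta2v_2$ and $c_2=\frac\beta2v_1+(1-\frac\beta2)v_2$.) Discs are either all open or all closed, which gives the open and the closed version of the graphs. In $G^s_\beta(S)$ two distinct segments $s_i,s_j$ are joined if and only if, for some $v_1\in s_i$ and $v_2\in s_j$, some lens of $v_1,v_2$ meets no segment of $S\setminus\{s_i,s_j\}$. Put $RNG(S)=G^s_2(S)$ and $GG(S)=G^s_1(S)$. Let $MST(S)$ be any spanning tree on $S$ that minimizes the sum, over its edges $s_is_j$, of $d(s_i,s_j)=\inf\{d(x,y):x\in s_i,\ y\in s_j\}$.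 A *segment triangulation* of $S$ is given by a set $T$ of pairwise disjoint open triangles (faces), each disjoint from all segments, with vertices in three distinct segments and with open edges that meet no segment, such that no such triangle can be added without intersecting another face. Its edges are the (possibly two-dimensional) connected components of $\mathrm{conv}(S)\setminus(F\cup\bigcup S)$, where $F$ is the union of the faces; an edge connects $s_i$ and $s_j$ if it contains an open line segment from a point of $s_i$ to a point of $s_j$. It is *Delaunay* if each face has an $l_p$ circumcircle with no point of $\bigcup S$ in its interior. $DT(S)$ is the multigraph with vertex set $S$ and one edge between $s_i$ and $s_j$ for each edge of the Delaunay segment triangulation that connects them. Let $1\le\beta\le\beta'\le2$. Then $$MST(S)\subseteq RNG(S)\subseteq G^s_{\beta'}(S)\subseteq G^s_\beta(S)\subseteq GG(S)\subseteq DT(S)$$ in the following sense. 1. For every minimum spanning tree, $MST(S)\subseteq RNG(S)$ in the open version; in the closed version as well, if no segment has the same distance to two different other segments. 2. In both versions, $RNG(S)\subseteq G^s_{\beta'}(S)\subseteq G^s_\beta(S)\subseteq GG(S)$. 3. Suppose that the segments are pairwise disjoint and in general position: no $l_p$ circle is tangent to four of them (a circle is tangent to a segment if the segment meets the circle but not its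 interior), and no $l_p$ circle contains the line segment between two different end points of segments of $S$ (this is automatic for $1<p<\infty$; for $p\in\{1,\infty\}$ it says that no line through two different end points is parallel to a side of the discs). Then in both versions $GG(S)\subseteq DT(S)$, for every Delaunay segment triangulation of $S$: if $s_i,s_j$ are joined in $GG(S)$, some edge of the triangulation connects them. The same holds for every maximal family $T$ of pairwise disjoint faces with empty circumcircles in place of a Delaunay segment triangulation, with edges defined in the same way. -/

import Mathlib

open Set Metric

open scoped ENNReal

namespace SegSkeleton

/-- The plane with the `l_p` metric. -/
abbrev Plane (p : ℝ≥0∞) : Type := PiLp p (fun _ : Fin 2 => ℝ)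

/-- Lenses are intersections of two open discs, or of two closed discs. -/
inductive DiscKind where
  | isOpen : DiscKind
  | isClosed : DiscKind

section

variable {p : ℝ≥0∞} [Fact (1 ≤ p)] {ι : Type*}

/-- The disc with centre `c` and radius `r`, open or closed. -/
def disc (κ : DiscKind) (c : Plane p) (r : ℝ) : Set (Plane p) :=
  match κ with
  | DiscKind.isOpen => ball c r
  | DiscKind.isClosed => closedBall c r

/-- The `i`-th segment of the family `S` with end points `a i`, `b i`. -/
def site (a b : ι → Plane p) (i : ι) : Set (Plane p) := segment ℝ (a i) (b i)

/-- The union of all segments of `S`. -/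
def sites (a b : ι → Plane p) : Set (Plane p) := ⋃ i, site a b i

/-! ### Beta-skeletons -/

/-- `c₁`, `c₂` are centres of discs determining a lens of `v₁`, `v₂` with parameter
`1 ≤ β < ∞`. (For `1 < p < ∞` these are the points `(1 - β/2) v₁ + (β/2) v₂` and
`(β/2) v₁ + (1 - β/2) v₂`; for `p = 1, ∞` there may be several such pairs.) -/
def IsLensCentres (β : ℝ) (v₁ v₂ c₁ c₂ : Plane p) : Prop :=
  dist c₁ c₂ = (β - 1) * dist v₁ v₂ ∧
  dist v₁ c₂ = |(β - 2) * dist v₁ v₂ / 2| ∧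
  dist v₂ c₁ = |(β - 2) * dist v₁ v₂ / 2|

/-- The set of all lenses with parameter `β` generated by points `v₁ ∈ s₁`, `v₂ ∈ s₂`. -/
def lenses (κ : DiscKind) (β : ℝ) (s₁ s₂ : Set (Plane p)) : Set (Set (Plane p)) :=
  {N | ∃ v₁ ∈ s₁, ∃ v₂ ∈ s₂, ∃ c₁ c₂, IsLensCentres β v₁ v₂ c₁ c₂ ∧
    N = disc κ c₁ (β * dist v₁ v₂ / 2) ∩ disc κ c₂ (β * dist v₁ v₂ / 2)}

lemma IsLensCentres.symm {β : ℝ} {v₁ v₂ c₁ c₂ : Plane p} (h : IsLensCentres β v₁ v₂ c₁ c₂) :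
    IsLensCentres β v₂ v₁ c₂ c₁ := by
  obtain ⟨h1, h2, h3⟩ := h
  refine ⟨?_, ?_, ?_⟩
  · rw [dist_comm c₂, dist_comm v₂]; exact h1
  · rw [dist_comm v₂ v₁]; exact h3
  · rw [dist_comm v₂ v₁]; exact h2

lemma lenses_comm (κ : DiscKind) (β : ℝ) (s₁ s₂ : Set (Plane p)) :
    lenses κ β s₁ s₂ ⊆ lenses κ β s₂ s₁ := by
  rintro N ⟨v₁, h₁, v₂, h₂, c₁, c₂, hc, rfl⟩
  exact ⟨v₂, h₂, v₁, h₁, c₂, c₁, hc.symm, by rw [dist_comm v₂ v₁, inter_comm]⟩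

/-- The lens-based `β`-skeleton of the segments, `1 ≤ β < ∞`: `i` and `j` are joined if some
lens generated by them is met by no other segment. -/
def skeleton (κ : DiscKind) (a b : ι → Plane p) (β : ℝ) : SimpleGraph ι where
  Adj i j := i ≠ j ∧ ∃ N ∈ lenses κ β (site a b i) (site a b j),
    ∀ k, k ≠ i → k ≠ j → N ∩ site a b k = ∅
  symm := ⟨fun _ _ ⟨hij, N, hN, h⟩ =>
    ⟨hij.symm, N, lenses_comm κ β _ _ hN, fun k hj hi => h k hi hj⟩⟩
  loopless := ⟨fun _ h => h.1 rfl⟩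

/-- The relative neighbourhood graph. -/
def RNG (κ : DiscKind) (a b : ι → Plane p) : SimpleGraph ι := skeleton κ a b 2

/-- The Gabriel graph. -/
def GG (κ : DiscKind) (a b : ι → Plane p) : SimpleGraph ι := skeleton κ a b 1

/-! ### Minimum spanning trees -/

/-- The distance between two sets: the infimum of the distances of their points. -/
noncomputable def setDist (s t : Set (Plane p)) : ℝ := sInf (image2 dist s t)

lemma setDist_comm (s t : Set (Plane p)) : setDist s t = setDist t s := by
  unfold setDist
  rw [image2_swap]
  simp only [dist_comm]

/-- The distance of the `i`-th and the `j`-th segment. -/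
noncomputable def siteDist (a b : ι → Plane p) (i j : ι) : ℝ :=
  setDist (site a b i) (site a b j)

open scoped Classical in
/-- The sum, over the edges of `M`, of the distances of the two segments joined by the edge. -/
noncomputable def weight [Fintype ι] (a b : ι → Plane p) (M : SimpleGraph ι) : ℝ :=
  ∑ e ∈ M.edgeFinset, Sym2.lift ⟨siteDist a b, fun _ _ => setDist_comm _ _⟩ e

/-- `M` is a minimum spanning tree of the segments. -/
def IsMST [Fintype ι] (a b : ι → Plane p) (M : SimpleGraph ι) : Prop :=
  M.IsTree ∧ ∀ M' : SimpleGraph ι, M'.IsTree → weight a b M ≤ weight a b M'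

/-- No segment has the same distance to two different other segments. -/
def NoTies (a b : ι → Plane p) : Prop :=
  ∀ i j k, i ≠ j → i ≠ k → j ≠ k → siteDist a b i j ≠ siteDist a b i k

/-! ### Segment triangulations -/

/-- `x 0`, `x 1`, `x 2` are the vertices of a triangle that may be a face of a segment
triangulation: they are not collinear and lie in three distinct segments, and neither the open
edges of the triangle nor its interior meet a segment. -/
def IsFaceTriple (a b : ι → Plane p) (x : Fin 3 → Plane p) : Prop :=
  AffineIndependent ℝ x ∧
  (∃ σ : Fin 3 → ι, Function.Injective σ ∧ ∀ k, x k ∈ site a b (σ k)) ∧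
  (∀ k l, k ≠ l → Disjoint (openSegment ℝ (x k) (x l)) (sites a b)) ∧
  Disjoint (interior (convexHull ℝ (range x))) (sites a b)

/-- `f` is an open triangle that may be a face of a segment triangulation. -/
def IsFace (a b : ι → Plane p) (f : Set (Plane p)) : Prop :=
  ∃ x : Fin 3 → Plane p, IsFaceTriple a b x ∧ f = interior (convexHull ℝ (range x))

/-- `T` is the set of faces of a segment triangulation of `S`: its members are possible faces
that are pairwise disjoint, and no face can be added without intersecting another one. -/
def IsSegTriangulation (a b : ι → Plane p) (T : Set (Set (Plane p))) : Prop :=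
  (∀ f ∈ T, IsFace a b f) ∧
  (∀ f ∈ T, ∀ g ∈ T, f ≠ g → Disjoint f g) ∧
  (∀ f, IsFace a b f → f ∉ T → ∃ g ∈ T, (f ∩ g).Nonempty)

/-- The part of the convex hull that is covered neither by segments nor by faces. -/
def edgeRegion (a b : ι → Plane p) (T : Set (Set (Plane p))) : Set (Plane p) :=
  convexHull ℝ (sites a b) \ (⋃₀ T ∪ sites a b)

/-- The (possibly two-dimensional) edges of the triangulation with set of faces `T`: the
connected components of what the faces and the segments leave of the convex hull. -/
def edges (a b : ι → Plane p) (T : Set (Set (Plane p))) : Set (Set (Plane p)) :=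
  {e | ∃ x ∈ edgeRegion a b T, e = connectedComponentIn (edgeRegion a b T) x}

/-- The edge `e` connects the segments `s` and `t`: it contains an open line segment
from a point of `s` to a point of `t`. -/
def Connects (e s t : Set (Plane p)) : Prop :=
  ∃ x ∈ s, ∃ y ∈ t, openSegment ℝ x y ⊆ e

/-- The adjacency relation of the multigraph that has `S` as set of vertices and one edge between
`i` and `j` for each edge of the triangulation that connects the segments `i` and `j`. -/
def triangulationGraph (a b : ι → Plane p) (T : Set (Set (Plane p))) : SimpleGraph ι where
  Adj i j := i ≠ j ∧ ∃ e ∈ edges a b T, Connects e (site a b i) (site a b j)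
  symm := ⟨fun _ _ ⟨hij, e, he, x, hx, y, hy, h⟩ =>
    ⟨hij.symm, e, he, y, hy, x, hx, by rw [openSegment_symm]; exact h⟩⟩
  loopless := ⟨fun _ h => h.1 rfl⟩

/-- `f` is a possible face with an `l_p` circumcircle that has no point of `S` in its interior.
(For `1 < p < ∞` a triangle has exactly one `l_p` circumcircle.) -/
def IsDelaunayFace (a b : ι → Plane p) (f : Set (Plane p)) : Prop :=
  ∃ x : Fin 3 → Plane p, IsFaceTriple a b x ∧ f = interior (convexHull ℝ (range x)) ∧
    ∃ (c : Plane p) (r : ℝ), (∀ k, x k ∈ sphere c r) ∧ Disjoint (ball c r) (sites a b)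

/-- `T` is the set of faces of a Delaunay segment triangulation of `S`: the circumcircle of each
face does not contain any point of `S` in its interior. -/
def IsDelaunay (a b : ι → Plane p) (T : Set (Set (Plane p))) : Prop :=
  IsSegTriangulation a b T ∧ ∀ f ∈ T, IsDelaunayFace a b f

/-- `T` is a maximal family of pairwise disjoint faces with empty circumcircles. Every Delaunay
segment triangulation is such a family, and such a family always exists; in the metrics `l_1` and
`l_∞` a triangle need not have a circumcircle, and `T` need not be a segment triangulation. -/
def IsMaxDelaunayFamily (a b : ι → Plane p) (T : Set (Set (Plane p))) : Prop :=
  (∀ f ∈ T, IsDelaunayFace a b f) ∧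
  (∀ f ∈ T, ∀ g ∈ T, f ≠ g → Disjoint f g) ∧
  (∀ f, IsDelaunayFace a b f → f ∉ T → ∃ g ∈ T, (f ∩ g).Nonempty)

/-! ### General position -/

/-- The circle with centre `c` and radius `r` is tangent to `s`: `s` meets the circle but not its
interior. -/
def IsTangent (c : Plane p) (r : ℝ) (s : Set (Plane p)) : Prop :=
  (s ∩ sphere c r).Nonempty ∧ Disjoint s (ball c r)

/-- General position: no `l_p` circle is tangent to four segments, and no `l_p` circle contains
the line segment between two different end points. (The second condition holds always for
`1 < p < ∞`; for `p = 1, ∞` it says that no line through two different end points is parallel to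
a side of the squares that are the discs of the metric.) -/
def GeneralPosition (a b : ι → Plane p) : Prop :=
  (∀ (c : Plane p) (r : ℝ) (σ : Fin 4 → ι), Function.Injective σ →
    ¬ ∀ k, IsTangent c r (site a b (σ k))) ∧
  (∀ e ∈ range a ∪ range b, ∀ e' ∈ range a ∪ range b, e ≠ e' →
    ∀ (c : Plane p) (r : ℝ), ¬ segment ℝ e e' ⊆ sphere c r)

end

end SegSkeleton

/-!
The inclusions between the skeletons of different parameters hold lens by lens
(`IsLensCentres.exists_of_le`), and an edge of a minimum spanning tree generates a lens that meets no
third segment, since otherwise it could be exchanged for a shorter edge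
(`IsMST.le_siteDist_or`).

The remaining inclusion is that of the Gabriel graph in the graph of a Delaunay triangulation. Only
the emptiness of the circumcircles of the faces matters for it. If `i` and `j` are joined in the
Gabriel graph, then the disc that shows this contains an empty disc that touches both segments, in
`x` and `y` say (`exists_isEmptyDisc`). It is enough that the open line segment from `x` to `y` meets
neither a segment nor a face, because then it lies in one of the edges of the triangulation.

* Segments: for strictly convex discs the chord runs in the interior of an empty disc. Otherwise it
  may lie on the circle and contain a point of contact of a third segment; then the disc can be moved
  away from the third segment (`IsEmptyDisc.exists_disjoint_openSegment`).
* Faces: let a chord `[x, y]` of the empty disc with centre `c` enter a face inscribed in the empty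
  disc with centre `c'`. If `x` and `y` are not both vertices of the face, then `[x, y]` crosses an
  edge `[u, v]` of the face and one of its end points is outside the second disc. In a normed plane,
  for crossing chords of this kind one of the radii `[x, c]`, `[y, c]` meets one of the radii
  `[u, c']`, `[v, c']` (`exists_mem_radius_inter_radius`). The triangle inequality then shows that the
  end points of the two meeting radii lie on both circles, and further that the line segment
  between them does, with both of them end points of segments: this is excluded by general position
  (`IsEmptyDisc.not_mem_radius_inter_radius`).

All of this works for an arbitrary norm of the plane. Strict convexity of the discs is replaced by the
condition that no circle contains the line segment between two end points, which implies that a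
segment touches an empty disc in one point only (`IsEmptyDisc.eq_of_mem`), and touches it in a
relatively interior point of a chord only with an end point
(`IsEmptyDisc.mem_range_of_mem_openSegment`).
-/

namespace SegSkeleton

/-! ### Inclusions between lenses -/

section Lenses

variable {p : ℝ≥0∞} [Fact (1 ≤ p)] {ι : Type*}

lemma disc_subset_disc {κ : DiscKind} {c c' : Plane p} {r r' : ℝ} (h : r + dist c c' ≤ r') :
    disc κ c r ⊆ disc κ c' r' := by
  cases κ
  · exact ball_subset_ball' h
  · exact closedBall_subset_closedBall' h

lemma ball_subset_disc (κ : DiscKind) (c : Plane p) (r : ℝ) : ball c r ⊆ disc κ c r := by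
  cases κ
  · exact subset_rfl
  · exact ball_subset_closedBall

/-- Every lens of parameter `β'` contains a lens of parameter `β` with the same generating points:
the points `v₁`, `c₂'`, `c₁'`, `v₂` lie in this order on a geodesic, and the new centres are found
on the segment from `c₂'` to `c₁'`, at distance `(β' - β) * d / 2` from its end points. -/
lemma IsLensCentres.exists_of_le {β β' : ℝ} (hβ : 1 ≤ β) (hββ' : β ≤ β') (hβ' : β' ≤ 2)
    {v₁ v₂ c₁' c₂' : Plane p} (h : IsLensCentres β' v₁ v₂ c₁' c₂') :
    ∃ c₁ c₂, IsLensCentres β v₁ v₂ c₁ c₂ ∧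
      dist c₁ c₁' ≤ (β' - β) * dist v₁ v₂ / 2 ∧ dist c₂ c₂' ≤ (β' - β) * dist v₁ v₂ / 2 := by
  obtain ⟨h1, h2, h3⟩ := h
  set d := dist v₁ v₂ with hd
  have hd0 : 0 ≤ d := dist_nonneg
  rw [show |(β' - 2) * d / 2| = (2 - β') * d / 2 by
    rw [abs_of_nonpos (by nlinarith)]; ring] at h2 h3
  obtain ⟨t, ht0, ht1, ht⟩ :
      ∃ t : ℝ, 0 ≤ t ∧ t ≤ 1 / 2 ∧ t * ((β' - 1) * d) = (β' - β) * d / 2 := by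
    rcases eq_or_lt_of_le (hβ.trans hββ') with h | h
    · exact ⟨0, le_rfl, by norm_num, by rw [show β' - β = 0 by linarith]; ring⟩
    · refine ⟨(β' - β) / (2 * (β' - 1)), by apply div_nonneg <;> linarith, ?_, ?_⟩
      · rw [div_le_div_iff₀ (by linarith) (by norm_num)]; linarith
      · have : β' - 1 ≠ 0 := by linarith
        field_simp
  have e1 : dist (AffineMap.lineMap c₁' c₂' t : Plane p) c₁' = (β' - β) * d / 2 := by
    rw [dist_lineMap_left, h1, Real.norm_of_nonneg ht0, ht]
  have e2 : dist (AffineMap.lineMap c₂' c₁' t : Plane p) c₂' = (β' - β) * d / 2 := by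
    rw [dist_lineMap_left, dist_comm, h1, Real.norm_of_nonneg ht0, ht]
  have e3 : dist (AffineMap.lineMap c₁' c₂' t : Plane p) (AffineMap.lineMap c₂' c₁' t)
      = (β - 1) * d := by
    rw [← AffineMap.lineMap_apply_one_sub c₁' c₂' t, dist_lineMap_lineMap, h1, Real.dist_eq,
      abs_of_nonpos (by linarith)]
    linarith
  refine ⟨_, _, ⟨e3, ?_, ?_⟩, e1.le, e2.le⟩ <;>
    rw [show |(β - 2) * d / 2| = (2 - β) * d / 2 by
      rw [abs_of_nonpos (by nlinarith)]; ring]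
  · generalize (AffineMap.lineMap c₁' c₂' t : Plane p) = c₁ at *
    generalize (AffineMap.lineMap c₂' c₁' t : Plane p) = c₂ at *
    have := dist_triangle v₁ c₂' c₂
    have := dist_triangle4 v₁ c₂ c₁ c₁'
    have := dist_triangle v₁ c₁' v₂
    rw [dist_comm c₂' c₂] at *
    rw [dist_comm c₂ c₁] at *
    rw [dist_comm c₁' v₂] at *
    linarith
  · generalize (AffineMap.lineMap c₁' c₂' t : Plane p) = c₁ at *
    generalize (AffineMap.lineMap c₂' c₁' t : Plane p) = c₂ at *
    have := dist_triangle v₂ c₁' c₁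
    have := dist_triangle4 v₂ c₁ c₂ c₂'
    have := dist_triangle v₁ c₂' v₂
    rw [dist_comm c₁' c₁] at *
    rw [dist_comm c₂' v₂] at *
    linarith

lemma skeleton_le_skeleton (κ : DiscKind) (a b : ι → Plane p) {β β' : ℝ} (hβ : 1 ≤ β)
    (hββ' : β ≤ β') (hβ' : β' ≤ 2) : skeleton κ a b β' ≤ skeleton κ a b β := by
  rintro i j ⟨hij, _, ⟨v₁, h₁, v₂, h₂, c₁', c₂', hc, rfl⟩, hN⟩
  obtain ⟨c₁, c₂, hc', hd₁, hd₂⟩ := hc.exists_of_le hβ hββ' hβ'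
  refine ⟨hij, _, ⟨v₁, h₁, v₂, h₂, c₁, c₂, hc', rfl⟩, fun k hki hkj => ?_⟩
  refine subset_empty_iff.1 ((inter_subset_inter_left _ (inter_subset_inter ?_ ?_)).trans
    (hN k hki hkj).subset) <;>
  exact disc_subset_disc (by linarith)

end Lenses

/-! ### Exchanging an edge of a tree -/

section Trees

variable {V : Type*}

open SimpleGraph

/-- After removal of an edge `i j`, each vertex that was connected to `i` is connected to `i` or to
`j`. -/
lemma reachable_deleteEdges_or {M : SimpleGraph V} {i j w : V} (h : M.Reachable w i) :
    (M.deleteEdges {s(i, j)}).Reachable w i ∨ (M.deleteEdges {s(i, j)}).Reachable w j := by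
  obtain ⟨W⟩ := h
  induction W with
  | nil => exact Or.inl (Reachable.refl _)
  | @cons u v _ huv _ ih =>
    by_cases he : s(u, v) = s(‹V›, j)
    · rcases Sym2.eq_iff.1 he with ⟨rfl, rfl⟩ | ⟨rfl, rfl⟩
      · exact Or.inl (Reachable.refl _)
      · exact Or.inr (Reachable.refl _)
    · have h' : (M.deleteEdges {s(‹V›, j)}).Adj u v := by
        rw [deleteEdges_adj]; exact ⟨huv, he⟩
      exact ih.imp h'.reachable.trans h'.reachable.trans

/-- An edge of a tree can be replaced by one of the edges that join one of its end points to a given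
third vertex. -/
lemma isTree_exchange {M : SimpleGraph V} (hM : M.IsTree) {i j k : V} (hij : M.Adj i j)
    (hki : k ≠ i) (hkj : k ≠ j) :
    ∃ l, (l = i ∨ l = j) ∧ ¬ M.Adj k l ∧ (M.deleteEdges {s(i, j)} ⊔ edge k l).IsTree := by
  have hbr : ¬ (M.deleteEdges {s(i, j)}).Reachable i j :=
    isBridge_iff.1 (isAcyclic_iff_forall_adj_isBridge.1 hM.isAcyclic hij)
  have hacyc : (M.deleteEdges {s(i, j)}).IsAcyclic := hM.isAcyclic.anti (deleteEdges_le _)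
  have hall := fun w => reachable_deleteEdges_or (j := j) (hM.connected.preconnected w i)
  set M' := M.deleteEdges {s(i, j)} with hM'
  have key : ∀ l m, (l = i ∧ m = j ∨ l = j ∧ m = i) → M'.Reachable k m →
      ¬ M.Adj k l ∧ (M' ⊔ edge k l).IsTree := by
    intro l m hlm hkm
    have hkl : ¬ M'.Reachable k l := by
      intro h
      have := h.symm.trans hkm
      rcases hlm with ⟨rfl, rfl⟩ | ⟨rfl, rfl⟩
      · exact hbr this
      · exact hbr this.symm
    have hne : k ≠ l := by rcases hlm with ⟨rfl, rfl⟩ | ⟨rfl, rfl⟩ <;> assumption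
    refine ⟨fun h => hkl (Adj.reachable ?_), ?_, ?_⟩
    · rw [hM', deleteEdges_adj]
      refine ⟨h, fun he => ?_⟩
      rcases Sym2.eq_iff.1 (mem_singleton_iff.1 he) with ⟨h, _⟩ | ⟨h, _⟩
      · exact hki h
      · exact hkj h
    · have hkl' : (M' ⊔ edge k l).Reachable k l := by
        refine Adj.reachable ?_
        simp [edge_adj, hne]
      have h1 : ∀ w, (M' ⊔ edge k l).Reachable w k := by
        intro w
        have hw : M'.Reachable w l ∨ M'.Reachable w m := by
          rcases hlm with ⟨rfl, rfl⟩ | ⟨rfl, rfl⟩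
          · exact hall w
          · exact (hall w).symm
        rcases hw with hw | hw
        · exact (hw.mono le_sup_left).trans hkl'.symm
        · exact (hw.trans hkm.symm).mono le_sup_left
      have : Nonempty V := ⟨k⟩
      exact ⟨fun u v => (h1 u).trans (h1 v).symm⟩
    · exact hacyc.sup_edge_of_not_reachable hkl
  rcases hall k with h | h
  · exact ⟨j, Or.inr rfl, key j i (Or.inr ⟨rfl, rfl⟩) h⟩
  · exact ⟨i, Or.inl rfl, key i j (Or.inl ⟨rfl, rfl⟩) h⟩

lemma sup_edge_deleteEdges {G : SimpleGraph V} {i j : V} (h : G.Adj i j) :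
    G.deleteEdges {s(i, j)} ⊔ edge i j = G := by
  ext u v
  simp only [sup_adj, deleteEdges_adj, edge_adj, mem_singleton_iff, Sym2.eq_iff]
  constructor
  · rintro (h' | ⟨⟨rfl, rfl⟩ | ⟨rfl, rfl⟩, -⟩)
    · exact h'.1
    · exact h
    · exact h.symm
  · intro h'
    by_cases he : u = i ∧ v = j ∨ u = j ∧ v = i
    · exact Or.inr ⟨by tauto, h'.ne⟩
    · exact Or.inl ⟨h', he⟩

end Trees

/-! ### Minimum spanning trees and relative neighbours -/

section MinimumSpanningTrees

variable {p : ℝ≥0∞} [Fact (1 ≤ p)] {ι : Type*}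

lemma setDist_le {s t : Set (Plane p)} {x y : Plane p} (hx : x ∈ s) (hy : y ∈ t) :
    setDist s t ≤ dist x y :=
  csInf_le ⟨0, by rintro _ ⟨_, _, _, _, rfl⟩; exact dist_nonneg⟩ (mem_image2_of_mem hx hy)

lemma isCompact_site (a b : ι → Plane p) (i : ι) : IsCompact (site a b i) := by
  rw [site, segment_eq_image_lineMap]
  exact isCompact_Icc.image AffineMap.lineMap_continuous

omit [Fact (1 ≤ p)] in
lemma site_nonempty (a b : ι → Plane p) (i : ι) : (site a b i).Nonempty :=
  ⟨a i, left_mem_segment ℝ _ _⟩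

lemma exists_dist_eq_siteDist (a b : ι → Plane p) (i j : ι) :
    ∃ x ∈ site a b i, ∃ y ∈ site a b j, dist x y = siteDist a b i j := by
  have hc : IsCompact (image2 dist (site a b i) (site a b j)) := by
    rw [← image_uncurry_prod]
    exact ((isCompact_site a b i).prod (isCompact_site a b j)).image continuous_dist
  obtain ⟨x, hx, y, hy, h⟩ :=
    hc.sInf_mem ((site_nonempty a b i).image2 (site_nonempty a b j))
  exact ⟨x, hx, y, hy, h⟩

/-- The lens of two closest points, with the two points as centres, shows that an edge `i j` is in
the relative neighbourhood graph. -/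
lemma RNG_adj_of_forall (κ : DiscKind) {a b : ι → Plane p} {i j : ι} (hij : i ≠ j)
    (h : ∀ v₁ ∈ site a b i, ∀ v₂ ∈ site a b j, dist v₁ v₂ = siteDist a b i j → ∀ k, k ≠ i → k ≠ j →
      ∀ z ∈ site a b k, z ∈ disc κ v₁ (siteDist a b i j) → z ∉ disc κ v₂ (siteDist a b i j)) :
    (RNG κ a b).Adj i j := by
  obtain ⟨v₁, h₁, v₂, h₂, hd⟩ := exists_dist_eq_siteDist a b i j
  refine ⟨hij, _, ⟨v₁, h₁, v₂, h₂, v₂, v₁, ⟨?_, ?_, ?_⟩, rfl⟩, fun k hki hkj => ?_⟩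
  · rw [dist_comm]; ring
  · simp
  · simp
  · rw [show 2 * dist v₁ v₂ / 2 = siteDist a b i j by rw [hd]; ring]
    exact eq_empty_iff_forall_notMem.2 fun z hz => h v₁ h₁ v₂ h₂ hd k hki hkj z hz.2 hz.1.2 hz.1.1

open SimpleGraph

variable [Fintype ι]

lemma weight_sup_edge (a b : ι → Plane p) {G : SimpleGraph ι} {i j : ι} (hij : i ≠ j)
    (hG : ¬ G.Adj i j) : weight a b (G ⊔ edge i j) = siteDist a b i j + weight a b G := by
  classical
  unfold weight
  have hmem : s(i, j) ∉ G.edgeFinset := by simpa using hG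
  rw [show siteDist a b i j = Sym2.lift ⟨siteDist a b, fun _ _ => setDist_comm _ _⟩ s(i, j) from
    rfl, ← Finset.sum_insert hmem]
  refine Finset.sum_congr ?_ fun _ _ => rfl
  ext e
  induction e with
  | h u v =>
    simp only [mem_edgeFinset, mem_edgeSet, sup_adj, edge_adj, Finset.mem_insert, Sym2.eq_iff]
    constructor
    · rintro (h | ⟨h, -⟩)
      · exact Or.inr h
      · exact Or.inl (by tauto)
    · rintro ((⟨rfl, rfl⟩ | ⟨rfl, rfl⟩) | h)
      · exact Or.inr ⟨by tauto, hij⟩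
      · exact Or.inr ⟨by tauto, hij.symm⟩
      · exact Or.inl h

/-- In the triangle formed by an edge of a minimum spanning tree and a third segment, that edge is
not strictly longer than both other sides. -/
lemma IsMST.le_siteDist_or {a b : ι → Plane p} {M : SimpleGraph ι} (hM : IsMST a b M) {i j k : ι}
    (hij : M.Adj i j) (hki : k ≠ i) (hkj : k ≠ j) :
    siteDist a b i j ≤ siteDist a b k i ∨ siteDist a b i j ≤ siteDist a b k j := by
  obtain ⟨l, hl, hkl, htree⟩ := isTree_exchange hM.1 hij hki hkj
  have hne : k ≠ l := by rcases hl with rfl | rfl <;> assumption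
  have h1 := hM.2 _ htree
  rw [weight_sup_edge a b hne (fun h => hkl (deleteEdges_le _ h))] at h1
  have h2 : weight a b M = _ := congrArg (weight a b) (sup_edge_deleteEdges hij).symm
  rw [weight_sup_edge a b hij.ne (by simp)] at h2
  rcases hl with rfl | rfl
  · left; linarith
  · right; linarith

lemma IsMST.le_RNG_isOpen {a b : ι → Plane p} {M : SimpleGraph ι} (hM : IsMST a b M) :
    M ≤ RNG DiscKind.isOpen a b := by
  intro i j hij
  refine RNG_adj_of_forall _ hij.ne fun v₁ h₁ v₂ h₂ _ k hki hkj z hz hz₁ hz₂ => ?_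
  have hz₁ : dist z v₁ < _ := hz₁
  have hz₂ : dist z v₂ < _ := hz₂
  rcases hM.le_siteDist_or hij hki hkj with h | h
  · exact absurd ((h.trans (setDist_le hz h₁)).trans_lt hz₁) (lt_irrefl _)
  · exact absurd ((h.trans (setDist_le hz h₂)).trans_lt hz₂) (lt_irrefl _)

lemma IsMST.le_RNG_isClosed {a b : ι → Plane p} (hties : NoTies a b) {M : SimpleGraph ι}
    (hM : IsMST a b M) : M ≤ RNG DiscKind.isClosed a b := by
  intro i j hij
  refine RNG_adj_of_forall _ hij.ne fun v₁ h₁ v₂ h₂ _ k hki hkj z hz hz₁ hz₂ => ?_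
  have hz₁ : dist z v₁ ≤ _ := hz₁
  have hz₂ : dist z v₂ ≤ _ := hz₂
  rcases hM.le_siteDist_or hij hki hkj with h | h
  · refine hties i j k hij.ne hki.symm hkj.symm (h.antisymm ?_ |>.trans (setDist_comm _ _))
    exact (setDist_le hz h₁).trans hz₁
  · refine hties j i k hij.ne.symm hkj.symm hki.symm
      ((setDist_comm _ _).trans (h.antisymm ?_) |>.trans (setDist_comm _ _))
    exact (setDist_le hz h₂).trans hz₂

end MinimumSpanningTrees

/-! ### Touching lines in a normed plane -/

section NormedPlane

variable {E : Type*} [NormedAddCommGroup E] [NormedSpace ℝ E]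

lemma exists_smul_eq_of_finrank_eq_two (hE : Module.finrank ℝ E = 2) {h : E →L[ℝ] ℝ} (hh : h ≠ 0)
    {d e : E} (hd0 : d ≠ 0) (hd : h d = 0) (he : h e = 0) : ∃ μ : ℝ, μ • d = e := by
  have : FiniteDimensional ℝ E := Module.finite_of_finrank_eq_succ hE
  have h1 := Module.Dual.finrank_ker_add_one_of_ne_zero (f := (h : E →ₗ[ℝ] ℝ))
    (fun h0 => hh (by ext w; exact LinearMap.congr_fun h0 w))
  obtain ⟨μ, hμ⟩ := (finrank_eq_one_iff_of_nonzero' (⟨d, hd⟩ : LinearMap.ker (h : E →ₗ[ℝ] ℝ))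
    (by simpa [Subtype.ext_iff] using hd0)).1 (by linarith [h1, hE]) ⟨e, he⟩
  exact ⟨μ, congrArg Subtype.val hμ⟩

lemma exists_separating {c : E} {r : ℝ} (hr : 0 < r) {s : Set E} (hs : Convex ℝ s)
    (hne : s.Nonempty) (hd : Disjoint s (ball c r)) :
    ∃ (h : E →L[ℝ] ℝ) (k : ℝ), h ≠ 0 ∧ (∀ w ∈ ball c r, h w < k) ∧
      (∀ w ∈ closedBall c r, h w ≤ k) ∧ ∀ w ∈ s, k ≤ h w := by
  obtain ⟨h, k, h1, h2⟩ := geometric_hahn_banach_open (convex_ball c r) isOpen_ball hs hd.symm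
  refine ⟨h, k, ?_, h1, ?_, h2⟩
  · rintro rfl
    obtain ⟨w, hw⟩ := hne
    have := h1 c (mem_ball_self hr)
    have := h2 w hw
    simp at *
    linarith
  · intro w hw
    rw [← closure_ball c hr.ne'] at hw
    exact closure_minimal (fun w hw => (h1 w hw).le) (isClosed_le h.continuous continuous_const) hw

lemma eq_and_eq_of_mem_openSegment {h : E →L[ℝ] ℝ} {k : ℝ} {x y q : E} (hq : q ∈ openSegment ℝ x y)
    (hx : h x ≤ k) (hy : h y ≤ k) (hk : k ≤ h q) : h x = k ∧ h y = k := by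
  obtain ⟨α, β, hα, hβ, hαβ, rfl⟩ := hq
  simp only [map_add, map_smul, smul_eq_mul] at hk
  obtain rfl : β = 1 - α := by linarith
  constructor <;> nlinarith

/-- A chord of a disc with a relatively interior point outside the open disc lies on the circle. -/
lemma segment_subset_sphere {c : E} {r : ℝ} (hr : 0 < r) {x y q : E} (hx : x ∈ closedBall c r)
    (hy : y ∈ closedBall c r) (hq : q ∈ openSegment ℝ x y) (hqb : q ∉ ball c r) :
    segment ℝ x y ⊆ sphere c r := by
  obtain ⟨h, k, -, h1, h2, h3⟩ := exists_separating (c := c) hr (convex_singleton q)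
    (singleton_nonempty q) (disjoint_singleton_left.2 hqb)
  obtain ⟨hxk, hyk⟩ := eq_and_eq_of_mem_openSegment hq (h2 x hx) (h2 y hy) (h3 q rfl)
  rintro w hw
  have hwc : w ∈ closedBall c r := (convex_closedBall c r).segment_subset hx hy hw
  have hwk : h w = k := by
    obtain ⟨α, β, hα, hβ, hαβ, rfl⟩ := hw
    simp only [map_add, map_smul, smul_eq_mul, hxk, hyk]
    rw [← add_mul, hαβ, one_mul]
  by_contra hws
  exact (h1 w (lt_of_le_of_ne hwc hws)).ne hwk

/-- A line segment that touches a disc of a normed plane in a relatively interior point of itself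
and of a chord of the disc is parallel to this chord: both lie on the only supporting line. -/
lemma exists_smul_eq_of_touching (hE : Module.finrank ℝ E = 2) {c : E} {r : ℝ} (hr : 0 < r)
    {p₁ p₂ e₁ e₂ x : E} (h₁ : p₁ ∈ closedBall c r) (h₂ : p₂ ∈ closedBall c r) (hne : p₁ ≠ p₂)
    (hx : x ∈ openSegment ℝ p₁ p₂) (hx' : x ∈ openSegment ℝ e₁ e₂)
    (hd : Disjoint (segment ℝ e₁ e₂) (ball c r)) : ∃ μ : ℝ, μ • (p₂ - p₁) = e₂ - e₁ := by
  obtain ⟨h, k, h0, -, h2, h3⟩ := exists_separating hr (convex_segment e₁ e₂)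
    ⟨e₁, left_mem_segment ℝ _ _⟩ hd
  obtain ⟨hp₁, hp₂⟩ := eq_and_eq_of_mem_openSegment hx (h2 _ h₁) (h2 _ h₂)
    (h3 x (openSegment_subset_segment ℝ _ _ hx'))
  have hxk : h x ≤ k :=
    h2 x ((convex_closedBall c r).segment_subset h₁ h₂ (openSegment_subset_segment ℝ _ _ hx))
  obtain ⟨he₁, he₂⟩ := eq_and_eq_of_mem_openSegment (h := -h) (k := -k) hx'
    (by simpa using h3 e₁ (left_mem_segment ℝ _ _)) (by simpa using h3 e₂ (right_mem_segment ℝ _ _))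
    (by simpa using hxk)
  simp only [neg_apply, neg_inj] at he₁ he₂
  exact exists_smul_eq_of_finrank_eq_two hE h0 (sub_ne_zero.2 hne.symm) (by simp [hp₁, hp₂])
    (by simp [he₁, he₂])

/-! ### Crossing chords of two discs -/

lemma coord_lineMap (B : AffineBasis (Fin 3) ℝ E) (i : Fin 3) (s t : E) (τ : ℝ) :
    B.coord i (AffineMap.lineMap s t τ) = (1 - τ) * B.coord i s + τ * B.coord i t := by
  rw [AffineMap.apply_lineMap, AffineMap.lineMap_apply_module, smul_eq_mul, smul_eq_mul]

/-- A segment that starts in a triangle and ends on the same side of the line through the vertices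
`0` and `1` as the triangle, but not in its interior, meets one of the other two sides. -/
lemma exists_mem_segment_of_coord (B : AffineBasis (Fin 3) ℝ E) {s t : E}
    (hs0 : 0 ≤ B.coord 0 s) (hs1 : 0 ≤ B.coord 1 s) (hs2 : 0 ≤ B.coord 2 s)
    (ht2 : 0 ≤ B.coord 2 t) (ht : B.coord 0 t ≤ 0 ∨ B.coord 1 t ≤ 0) :
    ∃ z ∈ segment ℝ s t, z ∈ segment ℝ (B 0) (B 2) ∨ z ∈ segment ℝ (B 1) (B 2) := by
  let f : ℝ → ℝ := fun τ =>
    min (AffineMap.lineMap (B.coord 0 s) (B.coord 0 t) τ)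
      (AffineMap.lineMap (B.coord 1 s) (B.coord 1 t) τ)
  have hf : Continuous f := AffineMap.lineMap_continuous.min AffineMap.lineMap_continuous
  obtain ⟨τ, hτ, hfτ⟩ := intermediate_value_Icc' zero_le_one hf.continuousOn
    (show (0 : ℝ) ∈ Icc (f 1) (f 0) by simpa [f] using ⟨ht, hs0, hs1⟩)
  set z : E := AffineMap.lineMap s t τ with hz
  have hz2 : 0 ≤ B.coord 2 z := by
    rw [hz, coord_lineMap]
    have := hτ.1
    have : 0 ≤ 1 - τ := by linarith [hτ.2]
    positivity
  have hf' : min (B.coord 0 z) (B.coord 1 z) = 0 := by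
    rw [← hfτ, hz, AffineMap.apply_lineMap, AffineMap.apply_lineMap]
  have hsum := B.sum_coord_apply_eq_one z
  have hcomb := B.linear_combination_coord_eq_self z
  rw [Fin.sum_univ_three] at hsum hcomb
  refine ⟨z, ?_, ?_⟩
  · rw [segment_eq_image_lineMap]; exact ⟨τ, hτ, rfl⟩
  · rcases min_eq_iff.1 hf' with ⟨h0, h1⟩ | ⟨h1, h0⟩
    · rw [h0, zero_add] at hsum
      rw [h0, zero_smul, zero_add] at hcomb
      exact Or.inr ⟨_, _, h0 ▸ h1, hz2, hsum, hcomb⟩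
    · rw [h1, add_zero] at hsum
      rw [h1, zero_smul, add_zero] at hcomb
      exact Or.inl ⟨_, _, h1 ▸ h0, hz2, hsum, hcomb⟩

lemma mem_segment_or_of_mem_line {u v c m : E} (hc : c ∈ line[ℝ, u, v]) (hm : m ∈ segment ℝ u v) :
    m ∈ segment ℝ u c ∨ m ∈ segment ℝ v c := by
  obtain ⟨t, rfl⟩ := (mem_affineSpan_pair_iff_exists_lineMap_eq).1 hc
  rw [segment_eq_image_lineMap] at hm
  obtain ⟨s, ⟨hs0, hs1⟩, rfl⟩ := hm
  rcases le_or_gt s t with h | h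
  · left
    rw [segment_eq_image_lineMap]
    rcases eq_or_lt_of_le (hs0.trans h) with h0 | h0
    · exact ⟨0, by simp, by simp [show s = 0 by linarith]⟩
    · refine ⟨s / t, ⟨by positivity, by rwa [div_le_one h0]⟩, ?_⟩
      simp only [AffineMap.lineMap_apply_module]
      match_scalars <;> field_simp
      ring
  · right
    rw [segment_eq_image_lineMap]
    have h0 : 0 < 1 - t := by linarith
    refine ⟨(1 - s) / (1 - t), ⟨by apply div_nonneg <;> linarith,
      by rw [div_le_one h0]; linarith⟩, ?_⟩
    simp only [AffineMap.lineMap_apply_module]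
    match_scalars <;> field_simp
    ring

/-- A triangle spanned by the centre and two points of a disc has its interior in the open disc. -/
lemma coord_nonpos_of_le_dist (B : AffineBasis (Fin 3) ℝ E) {r : ℝ} (hr : 0 < r)
    (h0 : dist (B 0) (B 2) ≤ r) (h1 : dist (B 1) (B 2) ≤ r) {t : E} (ht : r ≤ dist t (B 2))
    (ht2 : 0 < B.coord 2 t) : B.coord 0 t ≤ 0 ∨ B.coord 1 t ≤ 0 := by
  by_contra! hpos
  have hsum := B.sum_coord_apply_eq_one t
  have hcomb := B.linear_combination_coord_eq_self t
  rw [Fin.sum_univ_three] at hsum hcomb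
  have : t - B 2 = B.coord 0 t • (B 0 - B 2) + B.coord 1 t • (B 1 - B 2) := by
    nth_rw 1 [← hcomb]
    rw [show B.coord 2 t = 1 - B.coord 0 t - B.coord 1 t by linarith]
    module
  rw [dist_eq_norm] at h0 h1 ht
  rw [this] at ht
  have h2 := norm_add_le (B.coord 0 t • (B 0 - B 2)) (B.coord 1 t • (B 1 - B 2))
  rw [norm_smul, norm_smul, Real.norm_of_nonneg hpos.1.le, Real.norm_of_nonneg hpos.2.le] at h2
  nlinarith [mul_le_mul_of_nonneg_left h0 hpos.1.le, mul_le_mul_of_nonneg_left h1 hpos.2.le]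

lemma exists_affineBasis (hE : Module.finrank ℝ E = 2) {u v c : E} (huv : u ≠ v)
    (hc : c ∉ line[ℝ, u, v]) :
    ∃ B : AffineBasis (Fin 3) ℝ E, B 0 = u ∧ B 1 = v ∧ B 2 = c := by
  have : FiniteDimensional ℝ E := Module.finite_of_finrank_eq_succ hE
  have hi : AffineIndependent ℝ ![u, v, c] := affineIndependent_of_ne_of_mem_of_mem_of_notMem huv
    (left_mem_affineSpan_pair ℝ u v) (right_mem_affineSpan_pair ℝ u v) hc
  exact ⟨⟨![u, v, c], hi, hi.affineSpan_eq_top_iff_card_eq_finrank_add_one.2 (by simp [hE])⟩,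
    rfl, rfl, rfl⟩

lemma coord_eq_zero_of_mem_segment (B : AffineBasis (Fin 3) ℝ E) {m : E}
    (hm : m ∈ segment ℝ (B 0) (B 1)) :
    0 ≤ B.coord 0 m ∧ 0 ≤ B.coord 1 m ∧ B.coord 2 m = 0 := by
  rw [segment_eq_image_lineMap] at hm
  obtain ⟨t, ⟨h0, h1⟩, rfl⟩ := hm
  simp only [coord_lineMap, AffineBasis.coord_apply]
  refine ⟨?_, ?_, ?_⟩ <;> simp <;> linarith

lemma mem_line_of_coord_eq_zero (B : AffineBasis (Fin 3) ℝ E) {m : E} (hm : B.coord 2 m = 0) :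
    m ∈ line[ℝ, B 0, B 1] := by
  have hsum := B.sum_coord_apply_eq_one m
  have hcomb := B.linear_combination_coord_eq_self m
  rw [Fin.sum_univ_three, hm] at hsum hcomb
  rw [mem_affineSpan_pair_iff_exists_lineMap_eq]
  refine ⟨B.coord 1 m, ?_⟩
  rw [AffineMap.lineMap_apply_module]
  nth_rw 3 [← hcomb]
  rw [show B.coord 0 m = 1 - B.coord 1 m by linarith]
  simp

/-- Two points whose connecting line segment is crossed by the line through the vertices `0` and `1`
lie on different sides of it. -/
lemma coord_pos_or_neg (B : AffineBasis (Fin 3) ℝ E) {o x y : E}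
    (ho : o ∈ openSegment ℝ x y) (ho' : o ∈ segment ℝ (B 0) (B 1)) (hx : x ∉ line[ℝ, B 0, B 1]) :
    0 < B.coord 2 x ∧ B.coord 2 y < 0 ∨ B.coord 2 x < 0 ∧ 0 < B.coord 2 y := by
  have h0 := (coord_eq_zero_of_mem_segment B ho').2.2
  have hx0 : B.coord 2 x ≠ 0 := fun h => hx (mem_line_of_coord_eq_zero B h)
  rw [openSegment_eq_image_lineMap] at ho
  obtain ⟨t, ⟨ht0, ht1⟩, rfl⟩ := ho
  rw [coord_lineMap] at h0
  rcases lt_or_gt_of_ne hx0 with h | h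
  · exact Or.inr ⟨h, by nlinarith⟩
  · exact Or.inl ⟨h, by nlinarith⟩

/-- If a chord `[x, y]` of a disc with centre `c` is crossed by a segment `[u, v]` with end points
outside the open disc, then `[u, v]` meets one of the radii `[x, c]` and `[y, c]`. -/
lemma exists_mem_radius (hE : Module.finrank ℝ E = 2) {c : E} {r : ℝ} (hr : 0 < r) {x y u v o : E}
    (hne₁ : x ≠ y) (hx : dist x c ≤ r) (hy : dist y c ≤ r) (hu : r ≤ dist u c) (hv : r ≤ dist v c)
    (ho : o ∈ openSegment ℝ x y) (ho' : o ∈ openSegment ℝ u v) (hxy : u ∉ line[ℝ, x, y]) :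
    ∃ m ∈ segment ℝ u v, m ∈ segment ℝ x c ∨ m ∈ segment ℝ y c := by
  have hos := openSegment_subset_segment ℝ _ _ ho
  have hos' := openSegment_subset_segment ℝ _ _ ho'
  by_cases hc : c ∈ line[ℝ, x, y]
  · exact ⟨o, hos', mem_segment_or_of_mem_line hc hos⟩
  obtain ⟨B, rfl, rfl, rfl⟩ := exists_affineBasis hE hne₁ hc
  obtain ⟨h0, h1, h2⟩ := coord_eq_zero_of_mem_segment B hos
  have key : ∀ b ∈ segment ℝ u v, r ≤ dist b (B 2) → 0 < B.coord 2 b →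
      ∃ m ∈ segment ℝ u v, m ∈ segment ℝ (B 0) (B 2) ∨ m ∈ segment ℝ (B 1) (B 2) := by
    intro b hb hbr hb2
    obtain ⟨m, hm, hm'⟩ := exists_mem_segment_of_coord B h0 h1 h2.ge hb2.le
      (coord_nonpos_of_le_dist B hr hx hy hbr hb2)
    exact ⟨m, (convex_segment u v).segment_subset hos' hb hm, hm'⟩
  rcases coord_pos_or_neg B ho' hos hxy with h | h
  · exact key u (left_mem_segment ℝ _ _) hu h.1
  · exact key v (right_mem_segment ℝ _ _) hv h.2

/-- If a chord `[x, y]` of one disc, with end points outside a second open disc, crosses a chord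
`[u, v]` of the second disc, with end points outside the first open disc, then a radius of the
first disc that ends in `x` or `y` meets a radius of the second disc that ends in `u` or `v`. -/
lemma exists_mem_radius_inter_radius (hE : Module.finrank ℝ E = 2) {c c' : E} {r r' : ℝ}
    (hr : 0 < r) (hr' : 0 < r') {x y u v o : E} (hne₁ : x ≠ y) (hne₂ : u ≠ v)
    (hx : dist x c ≤ r) (hy : dist y c ≤ r) (hu : r ≤ dist u c) (hv : r ≤ dist v c)
    (hu' : dist u c' ≤ r') (hv' : dist v c' ≤ r') (hx' : r' ≤ dist x c') (hy' : r' ≤ dist y c')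
    (ho : o ∈ openSegment ℝ x y) (ho' : o ∈ openSegment ℝ u v) (hxy : u ∉ line[ℝ, x, y])
    (huv : x ∉ line[ℝ, u, v]) :
    ∃ a, (a = x ∨ a = y) ∧ ∃ b, (b = u ∨ b = v) ∧
      ∃ z, z ∈ segment ℝ a c ∧ z ∈ segment ℝ b c' := by
  obtain ⟨m, hm, hmc⟩ := exists_mem_radius hE hr hne₁ hx hy hu hv ho ho' hxy
  suffices h : ∃ z, (z ∈ segment ℝ x c ∨ z ∈ segment ℝ y c) ∧
      (z ∈ segment ℝ u c' ∨ z ∈ segment ℝ v c') by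
    obtain ⟨z, h1 | h1, h2 | h2⟩ := h
    exacts [⟨x, Or.inl rfl, u, Or.inl rfl, z, h1, h2⟩, ⟨x, Or.inl rfl, v, Or.inr rfl, z, h1, h2⟩,
      ⟨y, Or.inr rfl, u, Or.inl rfl, z, h1, h2⟩, ⟨y, Or.inr rfl, v, Or.inr rfl, z, h1, h2⟩]
  by_cases hc : c' ∈ line[ℝ, u, v]
  · exact ⟨m, hmc, mem_segment_or_of_mem_line hc hm⟩
  obtain ⟨B, rfl, rfl, rfl⟩ := exists_affineBasis hE hne₂ hc
  obtain ⟨h0, h1, h2⟩ := coord_eq_zero_of_mem_segment B hm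
  -- `s` is the end point of the chord on the side of the second centre; the part of the path
  -- `x c y` from `m` to `s` has to leave the triangle of `u`, `v` and the second centre
  have key : ∀ s t, 0 < B.coord 2 s → B.coord 2 t < 0 → r' ≤ dist s (B 2) →
      m ∈ segment ℝ s c ∨ m ∈ segment ℝ t c →
      ∃ z, (z ∈ segment ℝ s c ∨ z ∈ segment ℝ t c) ∧
        (z ∈ segment ℝ (B 0) (B 2) ∨ z ∈ segment ℝ (B 1) (B 2)) := by
    intro s t hs ht hsr hm
    have hs' := coord_nonpos_of_le_dist B hr' hu' hv' hsr hs
    rcases hm with hm | hm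
    · obtain ⟨z, hz, hz'⟩ := exists_mem_segment_of_coord B h0 h1 h2.ge hs.le hs'
      exact ⟨z, Or.inl ((convex_segment s c).segment_subset hm (left_mem_segment ℝ _ _) hz), hz'⟩
    · have hc2 : 0 ≤ B.coord 2 c := by
        have hm' := hm
        rw [segment_eq_image_lineMap] at hm'
        obtain ⟨τ, ⟨hτ0, hτ1⟩, rfl⟩ := hm'
        rw [coord_lineMap] at h2
        by_contra! hneg
        rcases eq_or_lt_of_le hτ0 with h | h
        · subst h; simp at h2; linarith
        · nlinarith
      by_cases hin : 0 ≤ B.coord 0 c ∧ 0 ≤ B.coord 1 c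
      · obtain ⟨z, hz, hz'⟩ := exists_mem_segment_of_coord B hin.1 hin.2 hc2 hs.le hs'
        exact ⟨z, Or.inl (by rwa [segment_symm]), hz'⟩
      · obtain ⟨z, hz, hz'⟩ := exists_mem_segment_of_coord B h0 h1 h2.ge hc2 (by
          by_contra! h; exact hin ⟨h.1.le, h.2.le⟩)
        exact ⟨z, Or.inr ((convex_segment t c).segment_subset hm (right_mem_segment ℝ _ _) hz), hz'⟩
  rcases coord_pos_or_neg B ho (openSegment_subset_segment ℝ _ _ ho') huv with h | h
  · exact key x y h.1 h.2 hx' hmc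
  · obtain ⟨z, hz, hz'⟩ := key y x h.2 h.1 hy' hmc.symm
    exact ⟨z, hz.symm, hz'⟩

end NormedPlane

/-! ### Meeting radii of two discs -/

section MeetingRadii

variable {E : Type*} [NormedAddCommGroup E] [NormedSpace ℝ E]

/-- If two radii, to `x` of one disc and to `v` of the other, meet, and neither `x` nor `v` is in the
interior of the respective other disc, then `x` and `v` lie on both circles. -/
lemma dist_eq_of_mem_radius_inter_radius {c c' x v z : E} {r r' : ℝ} (hx : dist x c ≤ r)
    (hv : r ≤ dist v c) (hv' : dist v c' ≤ r') (hx' : r' ≤ dist x c')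
    (hz : z ∈ segment ℝ x c) (hz' : z ∈ segment ℝ v c') :
    dist x c = r ∧ dist v c = r ∧ dist v c' = r' ∧ dist x c' = r' := by
  have h1 := dist_add_dist_of_mem_segment hz
  have h2 := dist_add_dist_of_mem_segment hz'
  have h3 := dist_triangle v z c
  have h4 := dist_triangle x z c'
  refine ⟨?_, ?_, ?_, ?_⟩ <;> linarith

/-- If radii of two discs that end in common points `x`, `v` of the two circles meet, but not in the
second centre, then `x` is a relatively interior point of a chord of the second disc: of the chord
from `v` to the image of `x` under the homothety that takes the first disc to the second one. -/
lemma exists_mem_openSegment_of_mem_radius_inter_radius {c c' x v z : E} {r r' : ℝ} (hr : 0 < r)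
    (hxv : x ≠ v) (hx : dist x c = r) (hv : dist v c = r) (hv' : dist v c' = r')
    (hx' : dist x c' = r') (hz : z ∈ segment ℝ x c) (hz' : z ∈ segment ℝ v c') (hzc : z ≠ c') :
    ∃ w ∈ closedBall c' r', w ≠ v ∧ x ∈ openSegment ℝ w v := by
  have h1 := dist_add_dist_of_mem_segment hz
  have h2 := dist_add_dist_of_mem_segment hz'
  have h3 := dist_triangle v z c
  have h4 := dist_triangle x z c'
  have hρ : dist x z = dist v z := by linarith
  have hρ0 : 0 < dist v z := by
    refine lt_of_le_of_ne dist_nonneg fun h => hxv ?_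
    rw [← h] at hρ
    rw [dist_eq_zero.1 hρ, dist_eq_zero.1 h.symm]
  have hr' : 0 < r' := by
    have : 0 ≤ dist z c' := dist_nonneg
    linarith
  rw [segment_eq_image_lineMap] at hz hz'
  obtain ⟨s, ⟨hs0, hs1⟩, rfl⟩ := hz
  obtain ⟨t, ⟨ht0, ht1⟩, ht⟩ := hz'
  have hsr : dist x (AffineMap.lineMap x c s) = s * r := by
    rw [dist_left_lineMap, hx, Real.norm_of_nonneg hs0]
  have htr : dist v (AffineMap.lineMap v c' t) = t * r' := by
    rw [dist_left_lineMap, hv', Real.norm_of_nonneg ht0]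
  rw [ht, ← hρ, hsr] at htr
  rw [← hρ, hsr] at hρ0
  have ht1 : t ≠ 1 := by
    rintro rfl
    exact hzc (by rw [← ht]; simp)
  have ht0 : t ≠ 0 := by
    rintro rfl
    linarith
  refine ⟨c' + (r' / r) • (x - c), ?_, ?_, ?_⟩
  · rw [mem_closedBall, dist_eq_norm, add_sub_cancel_left, norm_smul, ← dist_eq_norm, hx,
      Real.norm_of_nonneg (by positivity)]
    field_simp
    rfl
  all_goals
    have hx_eq : x = t • (c' + (r' / r) • (x - c)) + (1 - t) • v := by
      rw [AffineMap.lineMap_apply_module, AffineMap.lineMap_apply_module] at ht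
      have hs : t * (r' / r) = s := by field_simp; linarith
      rw [smul_add, smul_smul, hs]
      have : t • c' + (1 - t) • v = (1 - s) • x + s • c := by rw [← ht]; abel
      calc x = ((1 - s) • x + s • c) + s • (x - c) := by module
        _ = _ := by rw [← this]; abel
  · intro h
    rw [h] at hx_eq
    exact hxv (by rw [hx_eq]; module)
  · exact ⟨t, 1 - t, by positivity, by
      have := lt_of_le_of_ne ‹t ≤ 1› ht1; linarith, by ring, hx_eq.symm⟩

lemma closedBall_subset_closedBall_of_mem_segment {c c' x : E} {r r' : ℝ} (hx : dist x c = r)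
    (hx' : dist x c' = r') (hc : c' ∈ segment ℝ x c) : closedBall c' r' ⊆ closedBall c r := by
  have := dist_add_dist_of_mem_segment hc
  exact closedBall_subset_closedBall' (by linarith)

end MeetingRadii

/-! ### Empty discs in general position -/

section EmptyDiscs

variable {p : ℝ≥0∞} [Fact (1 ≤ p)] {ι : Type*} {a b : ι → Plane p}

omit [Fact (1 ≤ p)] in
lemma finrank_plane : Module.finrank ℝ (Plane p) = 2 := by
  rw [(WithLp.linearEquiv p ℝ (Fin 2 → ℝ)).finrank_eq]
  simp

/-- A nondegenerate disc whose interior is not met by any segment. -/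
def IsEmptyDisc (a b : ι → Plane p) (c : Plane p) (r : ℝ) : Prop :=
  0 < r ∧ Disjoint (ball c r) (sites a b)

omit [Fact (1 ≤ p)] in
lemma site_subset_sites (i : ι) : site a b i ⊆ sites a b := subset_iUnion (site a b) i

lemma IsEmptyDisc.disjoint {c : Plane p} {r : ℝ} (hB : IsEmptyDisc a b c r) (i : ι) :
    Disjoint (site a b i) (ball c r) :=
  (hB.2.mono_right (site_subset_sites i)).symm

lemma IsEmptyDisc.le_dist {c : Plane p} {r : ℝ} (hB : IsEmptyDisc a b c r) {i : ι} {x : Plane p}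
    (hx : x ∈ site a b i) : r ≤ dist x c :=
  not_lt.1 fun h => disjoint_left.1 (hB.disjoint i) hx h

/-- In general position no segment is parallel to a line segment on a circle. -/
lemma GeneralPosition.smul_ne (hG : GeneralPosition a b) {c : Plane p} {r : ℝ} {p₁ p₂ : Plane p}
    (hs : segment ℝ p₁ p₂ ⊆ sphere c r) {i : ι} (hab : a i ≠ b i) (μ : ℝ) :
    μ • (p₂ - p₁) ≠ b i - a i := by
  intro hμ
  have h0 : μ ≠ 0 := by
    rintro rfl
    rw [zero_smul] at hμ
    exact hab (sub_eq_zero.1 hμ.symm).symm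
  -- the homothety that takes `p₁`, `p₂` to the end points of the segment
  refine hG.2 (a i) (Or.inl ⟨i, rfl⟩) (b i) (Or.inr ⟨i, rfl⟩) hab
    (a i - μ • (p₁ - c)) (|μ| * r) ?_
  rintro w hw
  rw [segment_eq_image'] at hw
  obtain ⟨t, ht, rfl⟩ := hw
  have h1 : p₁ + t • (p₂ - p₁) ∈ sphere c r :=
    hs (by rw [segment_eq_image']; exact ⟨t, ht, rfl⟩)
  rw [mem_sphere, dist_eq_norm] at h1 ⊢
  rw [← hμ, ← h1, ← Real.norm_eq_abs, ← norm_smul]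
  congr 1
  module

/-- In general position a segment touches an empty disc in one point only. -/
lemma IsEmptyDisc.eq_of_mem (hG : GeneralPosition a b) {c : Plane p} {r : ℝ}
    (hB : IsEmptyDisc a b c r) {i : ι} {x y : Plane p} (hx : x ∈ site a b i) (hy : y ∈ site a b i)
    (hxc : x ∈ closedBall c r) (hyc : y ∈ closedBall c r) : x = y := by
  by_contra hne
  have hs : segment ℝ x y ⊆ sphere c r := fun w hw =>
    le_antisymm ((convex_closedBall c r).segment_subset hxc hyc hw)
      (hB.le_dist ((convex_segment (a i) (b i)).segment_subset hx hy hw))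
  rw [site, segment_eq_image'] at hx hy
  obtain ⟨s, -, rfl⟩ := hx
  obtain ⟨t, -, rfl⟩ := hy
  have hst : t - s ≠ 0 := fun h => hne (by rw [sub_eq_zero.1 h])
  have hab : a i ≠ b i := by
    rintro h
    simp [h] at hne
  refine hG.smul_ne hs hab (t - s)⁻¹ ?_
  rw [show a i + t • (b i - a i) - (a i + s • (b i - a i)) = (t - s) • (b i - a i) by module,
    smul_smul, inv_mul_cancel₀ hst, one_smul]

/-- In general position, a segment that touches an empty disc in a relatively interior point of a
chord ends there, since otherwise it would be parallel to the chord. -/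
lemma IsEmptyDisc.mem_range_of_mem_openSegment (hG : GeneralPosition a b) {c : Plane p} {r : ℝ}
    (hB : IsEmptyDisc a b c r) {i : ι} {x p₁ p₂ : Plane p} (hx : x ∈ site a b i)
    (h₁ : p₁ ∈ closedBall c r) (h₂ : p₂ ∈ closedBall c r) (hne : p₁ ≠ p₂)
    (hxp : x ∈ openSegment ℝ p₁ p₂) : x ∈ range a ∪ range b := by
  by_contra hend
  have hxo : x ∈ openSegment ℝ (a i) (b i) := mem_openSegment_of_ne_left_right
    (fun h => hend (Or.inl ⟨i, h⟩)) (fun h => hend (Or.inr ⟨i, h⟩)) hx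
  have hab : a i ≠ b i := by
    intro h
    rw [h, openSegment_same] at hxo
    exact hend (Or.inr ⟨i, hxo.symm⟩)
  obtain ⟨μ, hμ⟩ := exists_smul_eq_of_touching finrank_plane hB.1 h₁ h₂ hne hxp hxo (hB.disjoint i)
  exact hG.smul_ne (segment_subset_sphere hB.1 h₁ h₂ hxp
    fun h => disjoint_left.1 (hB.disjoint i) hx h) hab μ hμ

lemma IsEmptyDisc.isTangent {c : Plane p} {r : ℝ} (hB : IsEmptyDisc a b c r) {i : ι} {x : Plane p}
    (hx : x ∈ site a b i) (hxc : x ∈ closedBall c r) : IsTangent c r (site a b i) :=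
  ⟨⟨x, hx, le_antisymm hxc (hB.le_dist hx)⟩, hB.disjoint i⟩

/-- In general position an empty disc does not touch four segments. -/
lemma IsEmptyDisc.not_four (hG : GeneralPosition a b) {c : Plane p} {r : ℝ}
    (hB : IsEmptyDisc a b c r) {σ : Fin 4 → ι} (hσ : Function.Injective σ) {x : Fin 4 → Plane p}
    (hx : ∀ k, x k ∈ site a b (σ k)) : ¬ ∀ k, x k ∈ closedBall c r :=
  fun h => hG.1 c r σ hσ fun k => hB.isTangent (hx k) (h k)

/-- Let `x`, `y` be points of contact of one empty disc and `u`, `v` points of contact of another one,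
with `y` outside the second disc. Then the radii to `x` and `v` do not meet: otherwise `u` is
outside the first disc, as this would touch four segments, so that neither disc contains the
other; hence `[x, v]` is on the circles, and both `x` and `v` are end points of segments. -/
lemma IsEmptyDisc.not_mem_radius_inter_radius (hG : GeneralPosition a b) {c c' : Plane p}
    {r r' : ℝ} (hB : IsEmptyDisc a b c r) (hB' : IsEmptyDisc a b c' r') {i j k l : ι} (hij : i ≠ j)
    (hkl : k ≠ l) {x y u v z : Plane p} (hx : x ∈ site a b i) (hy : y ∈ site a b j)
    (hu : u ∈ site a b k) (hv : v ∈ site a b l) (hxc : x ∈ closedBall c r)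
    (hyc : y ∈ closedBall c r) (huc : u ∈ closedBall c' r') (hvc : v ∈ closedBall c' r')
    (hyc' : y ∉ closedBall c' r') (hxu : x ≠ u) (hxv : x ≠ v)
    (hz : z ∈ segment ℝ x c) (hz' : z ∈ segment ℝ v c') : False := by
  obtain ⟨h1, h2, h3, h4⟩ :=
    dist_eq_of_mem_radius_inter_radius hxc (hB.le_dist hv) hvc (hB'.le_dist hx) hz hz'
  have huc' : u ∉ closedBall c r := by
    intro huc'
    have hil : i ≠ l := by
      rintro rfl; exact hxv (hB.eq_of_mem hG hx hv hxc h2.le)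
    have hik : i ≠ k := by
      rintro rfl; exact hxu (hB.eq_of_mem hG hx hu hxc huc')
    have hjl : j ≠ l := by
      rintro rfl; exact hyc' (hB.eq_of_mem hG hy hv hyc h2.le ▸ hvc)
    have hjk : j ≠ k := by
      rintro rfl; exact hyc' (hB.eq_of_mem hG hy hu hyc huc' ▸ huc)
    refine hB.not_four hG (σ := ![i, j, k, l]) (x := ![x, y, u, v]) ?_ ?_ ?_
    · intro m n hmn
      fin_cases m <;> fin_cases n <;> first | rfl | (exfalso; revert hmn; simp; tauto)
    · intro m; fin_cases m <;> assumption
    · intro m; fin_cases m <;> first | assumption | exact h2.le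
  have hzc' : z ≠ c' := by
    rintro rfl
    exact huc' (closedBall_subset_closedBall_of_mem_segment h1 h4 hz huc)
  have hzc : z ≠ c := by
    rintro rfl
    exact hyc' (closedBall_subset_closedBall_of_mem_segment h3 h2 hz' hyc)
  obtain ⟨w, hw, hwv, hxw⟩ := exists_mem_openSegment_of_mem_radius_inter_radius hB.1 hxv h1 h2 h3 h4
    hz hz' hzc'
  obtain ⟨w', hw', hwx, hvw⟩ := exists_mem_openSegment_of_mem_radius_inter_radius hB'.1 hxv.symm
    h3 h4 h1 h2 hz' hz hzc
  refine hG.2 x (hB'.mem_range_of_mem_openSegment hG hx hw hvc hwv hxw) v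
    (hB.mem_range_of_mem_openSegment hG hv hw' hxc hwx hvw) hxv c' r' ?_
  refine ((convex_segment w v).segment_subset (openSegment_subset_segment ℝ _ _ hxw)
    (right_mem_segment ℝ _ _)).trans (segment_subset_sphere hB'.1 hw hvc hxw ?_)
  exact fun h => disjoint_left.1 (hB'.disjoint i) hx h

/-- A chord between two points of contact of an empty disc that leaves a second empty disc does not
cross a chord between two points of contact of the second disc. -/
lemma IsEmptyDisc.not_crossing (hG : GeneralPosition a b) {c c' : Plane p}
    {r r' : ℝ} (hB : IsEmptyDisc a b c r) (hB' : IsEmptyDisc a b c' r') {i j k l : ι} (hij : i ≠ j)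
    (hkl : k ≠ l) {x y u v o : Plane p} (hx : x ∈ site a b i) (hy : y ∈ site a b j)
    (hu : u ∈ site a b k) (hv : v ∈ site a b l) (hxc : x ∈ closedBall c r)
    (hyc : y ∈ closedBall c r) (huc : u ∈ closedBall c' r') (hvc : v ∈ closedBall c' r')
    (hyc' : y ∉ closedBall c' r') (hxy : u ∉ line[ℝ, x, y]) (huv : x ∉ line[ℝ, u, v])
    (hne₁ : x ≠ y) (hne₂ : u ≠ v) (ho : o ∈ openSegment ℝ x y) (ho' : o ∈ openSegment ℝ u v) :
    False := by
  have hxu : x ≠ u := by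
    rintro rfl; exact hxy (left_mem_affineSpan_pair ℝ _ _)
  have hxv : x ≠ v := by
    rintro rfl; exact huv (right_mem_affineSpan_pair ℝ _ _)
  obtain ⟨s, hs, t, ht, z, hz, hz'⟩ := exists_mem_radius_inter_radius finrank_plane hB.1 hB'.1 hne₁
    hne₂ hxc hyc (hB.le_dist hu) (hB.le_dist hv) huc hvc (hB'.le_dist hx) (hB'.le_dist hy) ho ho'
    hxy huv
  rcases hs with rfl | rfl
  · rcases ht with rfl | rfl
    · exact hB.not_mem_radius_inter_radius hG hB' hij hkl.symm hx hy hv hu hxc hyc hvc huc hyc' hxv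
        hxu hz hz'
    · exact hB.not_mem_radius_inter_radius hG hB' hij hkl hx hy hu hv hxc hyc huc hvc hyc' hxu
        hxv hz hz'
  · rcases ht with rfl | rfl
    · exact hyc' (dist_eq_of_mem_radius_inter_radius hyc (hB.le_dist hu) huc (hB'.le_dist hy)
        hz hz').2.2.2.le
    · exact hyc' (dist_eq_of_mem_radius_inter_radius hyc (hB.le_dist hv) hvc (hB'.le_dist hy)
        hz hz').2.2.2.le

end EmptyDiscs

/-! ### Leaving a triangle -/

section Exit

variable {E : Type*} [NormedAddCommGroup E] [NormedSpace ℝ E]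

/-- A segment from an interior point of a triangle to a point outside meets the boundary. -/
lemma exists_mem_openSegment_coord_eq_zero (B : AffineBasis (Fin 3) ℝ E) {s t : E}
    (hs : ∀ k, 0 < B.coord k s) (ht : ∃ k, B.coord k t < 0) :
    ∃ o ∈ openSegment ℝ s t, ∃ m, B.coord m o = 0 ∧ ∀ k, 0 ≤ B.coord k o := by
  let f : ℝ → ℝ := fun τ => Finset.univ.inf' Finset.univ_nonempty
    fun k => AffineMap.lineMap (B.coord k s) (B.coord k t) τ
  have hf : Continuous f := Continuous.finset_inf'_apply _ fun k _ => AffineMap.lineMap_continuous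
  have h0 : 0 < f 0 := by
    simp only [f, AffineMap.lineMap_apply_zero, Finset.lt_inf'_iff]
    exact fun k _ => hs k
  have h1 : f 1 < 0 := by
    simp only [f, AffineMap.lineMap_apply_one, Finset.inf'_lt_iff]
    obtain ⟨k, hk⟩ := ht
    exact ⟨k, Finset.mem_univ k, hk⟩
  obtain ⟨τ, hτ, hfτ⟩ := intermediate_value_Ioo' zero_le_one hf.continuousOn
    (show (0 : ℝ) ∈ Ioo (f 1) (f 0) from ⟨h1, h0⟩)
  refine ⟨AffineMap.lineMap s t τ, ?_, ?_⟩
  · rw [openSegment_eq_image_lineMap]; exact ⟨τ, hτ, rfl⟩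
  · obtain ⟨m, -, hm⟩ := Finset.exists_mem_eq_inf' Finset.univ_nonempty
      fun k : Fin 3 => AffineMap.lineMap (B.coord k s) (B.coord k t) τ
    refine ⟨m, ?_, fun k => ?_⟩
    · rw [AffineMap.apply_lineMap, ← hm]; exact hfτ
    · rw [AffineMap.apply_lineMap, ← hfτ]
      exact Finset.inf'_le _ (Finset.mem_univ k)

lemma mem_openSegment_of_mem_openSegment {x y q o : E} (hq : q ∈ openSegment ℝ x y)
    (ho : o ∈ openSegment ℝ q y) : o ∈ openSegment ℝ x y := by
  obtain ⟨α, β, hα, hβ, hαβ, rfl⟩ := hq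
  obtain ⟨γ, δ, hγ, hδ, hγδ, rfl⟩ := ho
  exact ⟨γ * α, γ * β + δ, by positivity, by positivity,
    by rw [← add_assoc, ← mul_add, hαβ, mul_one, hγδ], by module⟩

lemma coord_eq_zero_of_mem_line (B : AffineBasis (Fin 3) ℝ E) {k l m : Fin 3} (hkm : k ≠ m)
    (hlm : l ≠ m) {x : E} (hx : x ∈ line[ℝ, B k, B l]) : B.coord m x = 0 := by
  rw [mem_affineSpan_pair_iff_exists_lineMap_eq] at hx
  obtain ⟨t, rfl⟩ := hx
  rw [coord_lineMap, B.coord_apply_ne hkm.symm, B.coord_apply_ne hlm.symm]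
  ring

lemma mem_segment_of_coord_eq_zero (B : AffineBasis (Fin 3) ℝ E) {k l m : Fin 3} (hkl : k ≠ l)
    (hkm : k ≠ m) (hlm : l ≠ m) {x : E} (hm : B.coord m x = 0) (hx : ∀ k, 0 ≤ B.coord k x) :
    x ∈ segment ℝ (B k) (B l) := by
  have huniv : (Finset.univ : Finset (Fin 3)) = {k, l, m} := by
    clear hm; revert k l m; decide
  have hsum := B.sum_coord_apply_eq_one x
  have hcomb := B.linear_combination_coord_eq_self x
  rw [huniv, Finset.sum_insert (by simp [hkl, hkm]), Finset.sum_pair hlm, hm] at hsum hcomb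
  rw [zero_smul, add_zero] at hcomb
  rw [add_zero] at hsum
  exact ⟨_, _, hx k, hx l, hsum, hcomb⟩

end Exit

/-! ### Faces with empty circumcircles -/

section Faces

variable {p : ℝ≥0∞} [Fact (1 ≤ p)] {ι : Type*} {a b : ι → Plane p}

/-- The vertices of a face are the only points in which its empty circumcircle touches segments. -/
lemma IsEmptyDisc.mem_range_of_mem_closedBall (hG : GeneralPosition a b) {c : Plane p} {r : ℝ}
    (hB : IsEmptyDisc a b c r) {σ : Fin 3 → ι} (hσ : Function.Injective σ) {x : Fin 3 → Plane p}
    (hx : ∀ k, x k ∈ site a b (σ k)) (hxc : ∀ k, x k ∈ closedBall c r) {j : ι} {y : Plane p}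
    (hy : y ∈ site a b j) (hyc : y ∈ closedBall c r) : y ∈ range x := by
  by_cases hj : j ∈ range σ
  · obtain ⟨k, rfl⟩ := hj
    exact ⟨k, hB.eq_of_mem hG (hx k) hy (hxc k) hyc⟩
  · exact absurd (Fin.cons hyc hxc : ∀ k, (Fin.cons y x : Fin 4 → Plane p) k ∈ closedBall c r)
      (hB.not_four hG (σ := Fin.cons j σ) (Fin.cons_injective_iff.2 ⟨hj, hσ⟩) (Fin.cons hy hx))

/-- A chord that ends in a point of contact other than the vertices of the face leaves the face through
one of its edges, which would be a crossing of chords. -/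
lemma IsEmptyDisc.not_mem_face (hG : GeneralPosition a b) {c c' : Plane p}
    {r r' : ℝ} (hB : IsEmptyDisc a b c r) (hB' : IsEmptyDisc a b c' r') {i j : ι} (hij : i ≠ j)
    {x y : Plane p} (hx : x ∈ site a b i) (hy : y ∈ site a b j) (hxc : x ∈ closedBall c r)
    (hyc : y ∈ closedBall c r) (hxy : x ≠ y) (hd : Disjoint (openSegment ℝ x y) (sites a b))
    (B : AffineBasis (Fin 3) ℝ (Plane p)) {σ : Fin 3 → ι} (hσ : Function.Injective σ)
    (hBs : ∀ k, B k ∈ site a b (σ k)) (hBc : ∀ k, B k ∈ closedBall c' r') (hyB : y ∉ range B)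
    {q : Plane p} (hq : q ∈ openSegment ℝ x y) (hqB : ∀ k, 0 < B.coord k q) : False := by
  have hyc' : y ∉ closedBall c' r' :=
    fun h => hyB (hB'.mem_range_of_mem_closedBall hG hσ hBs hBc hy h)
  have hout : ∃ k, B.coord k y < 0 := by
    by_contra! h
    apply hyc'
    rw [← B.linear_combination_coord_eq_self y]
    exact (convex_closedBall c' r').sum_mem (fun k _ => h k) (B.sum_coord_apply_eq_one y)
      fun k _ => hBc k
  obtain ⟨o, ho, m, hm, hpos⟩ := exists_mem_openSegment_coord_eq_zero B hqB hout
  have hoxy : o ∈ openSegment ℝ x y :=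
    mem_openSegment_of_mem_openSegment hq ho
  obtain ⟨k, l, hkl, hkm, hlm⟩ : ∃ k l : Fin 3, k ≠ l ∧ k ≠ m ∧ l ≠ m := by
    clear hm; revert m; decide
  have hne : ∀ n, B n ≠ o := by
    rintro n rfl
    exact disjoint_left.1 hd hoxy (site_subset_sites _ (hBs n))
  have hokl : o ∈ openSegment ℝ (B k) (B l) :=
    mem_openSegment_of_ne_left_right (hne k) (hne l)
      (mem_segment_of_coord_eq_zero B hkl hkm hlm hm hpos)
  have hym : B.coord m y < 0 := by
    rw [openSegment_eq_image_lineMap] at ho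
    obtain ⟨t, ⟨ht0, ht1⟩, rfl⟩ := ho
    rw [coord_lineMap] at hm
    have := hqB m
    nlinarith
  have hxm : 0 < B.coord m x := by
    rw [openSegment_eq_image_lineMap] at hq
    obtain ⟨t, ⟨ht0, ht1⟩, rfl⟩ := hq
    have := hqB m
    rw [coord_lineMap] at this
    nlinarith
  refine hB.not_crossing hG hB' hij (hσ.ne hkl) hx hy (hBs k) (hBs l) hxc hyc (hBc k) (hBc l) hyc'
    ?_ ?_ hxy (fun h => hkl (B.ind.injective h)) hoxy hokl
  · -- the line through `x` and `y` meets the line through the two vertices in `o` only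
    intro hk
    rw [mem_affineSpan_pair_iff_exists_lineMap_eq] at hk
    obtain ⟨s, hs⟩ := hk
    rw [openSegment_eq_image_lineMap] at hoxy
    obtain ⟨t, -, ht⟩ := hoxy
    have h1 : B.coord m (B k) = 0 := B.coord_apply_ne hkm.symm
    rw [← hs, coord_lineMap] at h1
    rw [← ht, coord_lineMap] at hm
    have hst : s = t := by
      have : (s - t) * (B.coord m y - B.coord m x) = 0 := by linarith
      rcases mul_eq_zero.1 this with h | h <;> linarith
    exact hne k (by rw [← hs, ← ht, hst])
  · exact fun h => hxm.ne' (coord_eq_zero_of_mem_line B hkm hlm h)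

/-- In general position, no line segment between the two points where two segments touch an empty
disc meets a face with an empty circumcircle, unless it meets a segment. -/
lemma IsEmptyDisc.disjoint_face (hG : GeneralPosition a b) {c : Plane p}
    {r : ℝ} (hB : IsEmptyDisc a b c r) {i j : ι} (hij : i ≠ j)
    {x y : Plane p} (hx : x ∈ site a b i) (hy : y ∈ site a b j) (hxc : x ∈ closedBall c r)
    (hyc : y ∈ closedBall c r) (hxy : x ≠ y) (hd : Disjoint (openSegment ℝ x y) (sites a b))
    {f : Set (Plane p)} (hf : IsDelaunayFace a b f) : Disjoint (openSegment ℝ x y) f := by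
  obtain ⟨w, ⟨hind, ⟨σ, hσ, hw⟩, -, -⟩, rfl, c', r', hwc, hd'⟩ := hf
  have hr' : 0 < r' := by
    refine lt_of_le_of_ne (by rw [← mem_sphere.1 (hwc 0)]; exact dist_nonneg) ?_
    rintro rfl
    have h0 := mem_sphere.1 (hwc 0)
    have h1 := mem_sphere.1 (hwc 1)
    rw [dist_eq_zero] at h0 h1
    exact absurd (hind.injective (h0.trans h1.symm)) (by decide)
  let B : AffineBasis (Fin 3) ℝ (Plane p) :=
    ⟨w, hind, hind.affineSpan_eq_top_iff_card_eq_finrank_add_one.2 (by simp [finrank_plane])⟩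
  have hB' : IsEmptyDisc a b c' r' := ⟨hr', hd'⟩
  have hwc' : ∀ k, B k ∈ closedBall c' r' := fun k => sphere_subset_closedBall (hwc k)
  rw [disjoint_left]
  intro q hq hqf
  rw [show w = B from rfl, B.interior_convexHull] at hqf
  by_cases hyB : y ∈ range B
  · by_cases hxB : x ∈ range B
    · obtain ⟨k, rfl⟩ := hxB
      obtain ⟨l, rfl⟩ := hyB
      obtain ⟨m, hkm, hlm⟩ : ∃ m : Fin 3, k ≠ m ∧ l ≠ m := by
        have : ∀ k l : Fin 3, ∃ m, k ≠ m ∧ l ≠ m := by decide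
        exact this k l
      refine (hqf m).ne' (coord_eq_zero_of_mem_line B hkm hlm ?_)
      rw [openSegment_eq_image_lineMap] at hq
      obtain ⟨t, -, rfl⟩ := hq
      exact AffineMap.lineMap_mem_affineSpan_pair t _ _
    · exact hB.not_mem_face hG hB' hij.symm hy hx hyc hxc hxy.symm
        (by rwa [openSegment_symm]) B hσ hw hwc' hxB (by rwa [openSegment_symm]) hqf
  · exact hB.not_mem_face hG hB' hij hx hy hxc hyc hxy hd B hσ hw hwc' hyB hq hqf

end Faces

/-! ### Empty discs with an unobstructed chord -/

section Unobstructed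

variable {p : ℝ≥0∞} [Fact (1 ≤ p)] {ι : Type*} {a b : ι → Plane p}

open Filter Topology in
lemma eventually_add_smul_mem_segment {E : Type*} [AddCommGroup E] [Module ℝ E] {x u v : E}
    (hx : x ∈ openSegment ℝ u v) (s : ℝ) :
    ∀ᶠ t in 𝓝 (0 : ℝ), x + t • s • (v - u) ∈ segment ℝ u v := by
  rw [openSegment_eq_image'] at hx
  obtain ⟨τ, hτ, rfl⟩ := hx
  have h1 : Tendsto (fun t : ℝ => τ + t * s) (𝓝 0) (𝓝 τ) := by
    have : Continuous fun t : ℝ => τ + t * s := by fun_prop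
    simpa using this.tendsto 0
  filter_upwards [h1.eventually (isOpen_Ioo.mem_nhds hτ)] with t ht
  rw [segment_eq_image']
  exact ⟨τ + t * s, Ioo_subset_Icc_self ht, by module⟩

/-- The line through a segment that touches an empty disc in a relatively interior point supports
the disc. -/
lemma IsEmptyDisc.exists_supporting {c : Plane p} {r : ℝ} (hB : IsEmptyDisc a b c r) {n : ι}
    {w : Plane p} (hw : w ∈ openSegment ℝ (a n) (b n)) (hwc : w ∈ closedBall c r) :
    ∃ h : Plane p →L[ℝ] ℝ, h (b n - a n) = 0 ∧ (∀ w' ∈ ball c r, h w' < h w) ∧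
      ∀ w' ∈ site a b n, h w' = h w := by
  obtain ⟨h, κ, -, hhb, hhc, hhn⟩ := exists_separating hB.1 (convex_segment (a n) (b n))
    ⟨a n, left_mem_segment ℝ _ _⟩ (hB.disjoint n)
  have hwκ : h w = κ := (hhc w hwc).antisymm (hhn w (openSegment_subset_segment ℝ _ _ hw))
  obtain ⟨ha, hb⟩ := eq_and_eq_of_mem_openSegment (h := -h) (k := -κ) hw
    (by simpa using hhn _ (left_mem_segment ℝ _ _))
    (by simpa using hhn _ (right_mem_segment ℝ _ _)) (by simpa using hwκ.le)
  simp only [neg_apply, neg_inj] at ha hb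
  refine ⟨h, by rw [map_sub, ha, hb, sub_self], ?_, ?_⟩
  · rw [hwκ]; exact hhb
  · rintro w' ⟨α, β, hα, hβ, hαβ, rfl⟩
    rw [hwκ, map_add, map_smul, map_smul, ha, hb, ← add_smul, hαβ, one_smul]

/-- In general position, an empty disc that touches three segments has a positive distance to each
further segment. -/
lemma IsEmptyDisc.lt_infDist (hG : GeneralPosition a b) {c : Plane p} {r : ℝ}
    (hB : IsEmptyDisc a b c r) {i j k l : ι} (hij : i ≠ j) (hki : k ≠ i) (hkj : k ≠ j) (hli : l ≠ i)
    (hlj : l ≠ j) (hlk : l ≠ k) {x y q : Plane p} (hx : x ∈ site a b i) (hy : y ∈ site a b j)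
    (hq : q ∈ site a b k) (hxc : x ∈ closedBall c r) (hyc : y ∈ closedBall c r)
    (hqc : q ∈ closedBall c r) : r < infDist c (site a b l) := by
  obtain ⟨w, hw, hwd⟩ := (isCompact_site a b l).exists_infDist_eq_dist (site_nonempty a b l) c
  rw [hwd]
  by_contra! hwc
  rw [dist_comm] at hwc
  refine hB.not_four hG (σ := ![i, j, k, l]) (x := ![x, y, q, w]) ?_ ?_ ?_
  · intro m n hmn
    fin_cases m <;> fin_cases n <;> first | rfl | (exfalso; revert hmn; simp; tauto)
  · intro m; fin_cases m <;> assumption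
  · intro m; fin_cases m <;> assumption

lemma map_homothety {E : Type*} [AddCommGroup E] [TopologicalSpace E] [Module ℝ E] (g : E →L[ℝ] ℝ)
    (x e w : E) (t s : ℝ) : g (x + t • e + s • (w - x)) = g x + t * g e + s * (g w - g x) := by
  simp only [map_add, map_smul, map_sub, smul_eq_mul]

open Filter Topology in
/-- Suppose that an empty disc touches two segments in relatively interior points `x` and `y`, and a
third one in a point between `x` and `y`. Moving `x` and `y` a little along their segments, away
from the third segment and parallel to `[x, y]`, and the disc with them by a homothety, gives
an empty disc that touches no third segment. -/
lemma IsEmptyDisc.exists_homothetic [Finite ι] (hG : GeneralPosition a b) {c : Plane p} {r : ℝ}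
    (hB : IsEmptyDisc a b c r) {i j k : ι} (hij : i ≠ j) (hki : k ≠ i) (hkj : k ≠ j)
    {x y q : Plane p} (hxy : x ≠ y) (hx : x ∈ openSegment ℝ (a i) (b i))
    (hy : y ∈ openSegment ℝ (a j) (b j)) (hai : a i ≠ b i) (haj : a j ≠ b j)
    (hxc : x ∈ closedBall c r) (hyc : y ∈ closedBall c r) (hq : q ∈ openSegment ℝ x y)
    (hqk : q ∈ site a b k) :
    ∃ (c' : Plane p) (r' : ℝ), IsEmptyDisc a b c' r' ∧ (site a b i ∩ closedBall c' r').Nonempty ∧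
      (site a b j ∩ closedBall c' r').Nonempty ∧
      ∀ l, l ≠ i → l ≠ j → Disjoint (site a b l) (closedBall c' r') := by
  have hxs := openSegment_subset_segment ℝ _ _ hx
  have hys := openSegment_subset_segment ℝ _ _ hy
  have hqc : q ∈ closedBall c r :=
    (convex_closedBall c r).segment_subset hxc hyc (openSegment_subset_segment ℝ _ _ hq)
  have hsph : segment ℝ x y ⊆ sphere c r := segment_subset_sphere hB.1 hxc hyc hq
    fun h => disjoint_left.1 (hB.disjoint k) hqk h
  -- the line through `x` and `y`
  obtain ⟨g, κ, hg0, -, hgc, hgk⟩ := exists_separating hB.1 (convex_segment (a k) (b k))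
    ⟨a k, left_mem_segment ℝ _ _⟩ (hB.disjoint k)
  obtain ⟨hgx, hgy⟩ := eq_and_eq_of_mem_openSegment hq (hgc x hxc) (hgc y hyc) (hgk q hqk)
  have hpar : ∀ n, a n ≠ b n → g (b n - a n) ≠ 0 := by
    intro n hab hg
    obtain ⟨μ, hμ⟩ := exists_smul_eq_of_finrank_eq_two finrank_plane hg0
      (sub_ne_zero.2 hxy.symm) (by rw [map_sub, hgx, hgy, sub_self]) hg
    exact hG.smul_ne hsph hab μ hμ
  -- the lines through the two segments
  obtain ⟨hi, hie, hib, his⟩ := hB.exists_supporting hx hxc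
  have hgi := hpar i hai
  obtain ⟨hj, hje, hjb, hjs⟩ := hB.exists_supporting hy hyc
  have hgj := hpar j haj
  -- velocities of the two points: both move away from the third segment with unit speed
  obtain ⟨ei, hei⟩ : ∃ e, e = (-(g (b i - a i))⁻¹) • (b i - a i) := ⟨_, rfl⟩
  obtain ⟨ej, hej⟩ : ∃ e, e = (-(g (b j - a j))⁻¹) • (b j - a j) := ⟨_, rfl⟩
  have hgei : g ei = -1 := by
    rw [hei, map_smul, smul_eq_mul, neg_mul, inv_mul_cancel₀ hgi]
  have hgej : g ej = -1 := by
    rw [hej, map_smul, smul_eq_mul, neg_mul, inv_mul_cancel₀ hgj]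
  have hhei : hi ei = 0 := by rw [hei, map_smul, hie, smul_zero]
  have hhej : hj ej = 0 := by rw [hej, map_smul, hje, smul_zero]
  obtain ⟨m, hm⟩ := exists_smul_eq_of_finrank_eq_two finrank_plane hg0
    (sub_ne_zero.2 hxy.symm) (by rw [map_sub, hgx, hgy, sub_self] : g (y - x) = 0)
    (by rw [map_sub, hgei, hgej, sub_self] : g (ej - ei) = 0)
  -- for small `t` the disc stays away from all segments that it does not touch
  have ev1 : ∀ᶠ t in 𝓝 (0 : ℝ), 0 < 1 + t * m := by
    have : Continuous fun t : ℝ => 1 + t * m := by fun_prop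
    exact (this.tendsto 0).eventually (lt_mem_nhds (by simp))
  have ev2 : ∀ᶠ t in 𝓝 (0 : ℝ), ∀ l, l ≠ i → l ≠ j → l ≠ k →
      (1 + t * m) * r < infDist (x + t • ei + (1 + t * m) • (c - x)) (site a b l) := by
    refine eventually_all.2 fun l => ?_
    by_cases hl : l ≠ i ∧ l ≠ j ∧ l ≠ k
    · have hrl : 0 < infDist c (site a b l) - r := sub_pos.2
        (hB.lt_infDist hG hij hki hkj hl.1 hl.2.1 hl.2.2 hxs hys hqk hxc hyc hqc)
      have hcont : Continuous fun t : ℝ =>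
          infDist (x + t • ei + (1 + t * m) • (c - x)) (site a b l) - (1 + t * m) * r := by
        refine ((continuous_infDist_pt _).comp ?_).sub ?_ <;> fun_prop
      filter_upwards [(hcont.tendsto 0).eventually (lt_mem_nhds (a := 0)
        (by simpa using hrl))] with t ht
      exact fun _ _ _ => sub_pos.1 ht
    · exact Eventually.of_forall fun t h1 h2 h3 => absurd ⟨h1, h2, h3⟩ hl
  have ev3 := eventually_add_smul_mem_segment hx (-(g (b i - a i))⁻¹)
  have ev4 := eventually_add_smul_mem_segment hy (-(g (b j - a j))⁻¹)
  rw [← hei] at ev3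
  rw [← hej] at ev4
  obtain ⟨t, ⟨⟨⟨ht1, ht2⟩, ht3⟩, ht4⟩, ht0⟩ :=
    (((ev1.and ev2).and ev3).and ev4 |>.filter_mono nhdsWithin_le_nhds |>.and
      (self_mem_nhdsWithin : Ioi (0 : ℝ) ∈ 𝓝[>] 0)).exists
  have ht0 : 0 < t := ht0
  obtain ⟨Λ, hΛ⟩ : ∃ Λ, Λ = 1 + t * m := ⟨_, rfl⟩
  rw [← hΛ] at ht1 ht2
  -- the homothety takes `c` to the new centre, `x` to `x + t • ei` and `y` to `y + t • ej`
  have hyt : y + t • ej = x + t • ei + Λ • (y - x) := by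
    rw [hΛ, add_smul, mul_smul, hm]; module
  have hdist : ∀ w, dist (x + t • ei + Λ • (w - x)) (x + t • ei + Λ • (c - x)) = Λ * dist w c := by
    intro w
    rw [dist_add_left, dist_smul₀, dist_sub_right, Real.norm_of_nonneg ht1.le]
  have hpre : ∀ w, ∃ w', w = x + t • ei + Λ • (w' - x) := fun w =>
    ⟨x + Λ⁻¹ • (w - (x + t • ei)), by
      rw [add_sub_cancel_left, smul_smul, mul_inv_cancel₀ ht1.ne', one_smul]; abel⟩
  have hother : ∀ l, l ≠ i → l ≠ j →
      Disjoint (site a b l) (closedBall (x + t • ei + Λ • (c - x)) (Λ * r)) := by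
    intro l hli hlj
    rw [disjoint_left]
    intro w hw hwc
    by_cases hlk : l = k
    · subst hlk
      obtain ⟨w', rfl⟩ := hpre w
      rw [mem_closedBall, hdist, mul_le_mul_iff_right₀ ht1] at hwc
      have h1 := hgc w' hwc
      have h2 := hgk _ hw
      rw [map_homothety, hgx, hgei] at h2
      nlinarith
    · have := (infDist_le_dist_of_mem hw).trans ((dist_comm _ _).le.trans hwc)
      exact absurd (ht2 l hli hlj hlk) this.not_gt
  refine ⟨_, Λ * r, ⟨mul_pos ht1 hB.1, ?_⟩, ⟨_, ht3, ?_⟩, ⟨_, ht4, ?_⟩, hother⟩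
  · rw [disjoint_left]
    intro w hwc hw
    obtain ⟨l, hl⟩ := mem_iUnion.1 hw
    by_cases hli : l = i
    · subst hli
      have h1 := his _ hl
      obtain ⟨w', rfl⟩ := hpre w
      rw [mem_ball, hdist, mul_lt_mul_iff_right₀ ht1] at hwc
      have h2 := hib w' hwc
      rw [map_homothety, hhei] at h1
      nlinarith
    by_cases hlj : l = j
    · subst hlj
      have h1 := hjs _ hl
      obtain ⟨w', rfl⟩ := hpre w
      rw [mem_ball, hdist, mul_lt_mul_iff_right₀ ht1] at hwc
      have h2 := hjb w' hwc
      rw [show x + t • ei + Λ • (w' - x) = y + t • ej + Λ • (w' - y) by rw [hyt]; module] at h1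
      rw [map_homothety, hhej] at h1
      nlinarith
    exact disjoint_left.1 (hother l hli hlj) hl (ball_subset_closedBall hwc)
  · have := hdist x
    rw [sub_self, smul_zero, add_zero] at this
    rw [mem_closedBall, this]
    exact mul_le_mul_of_nonneg_left hxc ht1.le
  · rw [hyt, mem_closedBall, hdist]
    exact mul_le_mul_of_nonneg_left hyc ht1.le

/-- If an empty disc touches two segments, then such a disc can be chosen so that no segment meets
the line segment between the points of contact. For strictly convex discs this is always so. -/
lemma IsEmptyDisc.exists_disjoint_openSegment [Finite ι] (hG : GeneralPosition a b)
    (hS : Pairwise fun i j => Disjoint (site a b i) (site a b j)) {c : Plane p} {r : ℝ}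
    (hB : IsEmptyDisc a b c r) {i j : ι} (hij : i ≠ j) (hi : (site a b i ∩ closedBall c r).Nonempty)
    (hj : (site a b j ∩ closedBall c r).Nonempty) :
    ∃ (c' : Plane p) (r' : ℝ), IsEmptyDisc a b c' r' ∧ ∃ x ∈ site a b i, ∃ y ∈ site a b j,
      x ∈ closedBall c' r' ∧ y ∈ closedBall c' r' ∧ Disjoint (openSegment ℝ x y) (sites a b) := by
  obtain ⟨x, hx, hxc⟩ := hi
  obtain ⟨y, hy, hyc⟩ := hj
  have hself : ∀ {c' : Plane p} {r' : ℝ} {x y : Plane p}, IsEmptyDisc a b c' r' → x ∈ site a b i →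
      y ∈ site a b j → x ∈ closedBall c' r' → y ∈ closedBall c' r' → ∀ {k q},
      q ∈ openSegment ℝ x y → q ∈ site a b k → k ≠ i ∧ k ≠ j := by
    intro c' r' x y hB' hx hy hxc hyc k q hq hqk
    have hqc : q ∈ closedBall c' r' :=
      (convex_closedBall _ _).segment_subset hxc hyc (openSegment_subset_segment ℝ _ _ hq)
    have hxy : x ≠ y := by
      rintro rfl
      exact disjoint_left.1 (hS hij) hx hy
    constructor
    · rintro rfl
      have := hB'.eq_of_mem hG hx hqk hxc hqc
      subst this
      exact hxy (left_mem_openSegment_iff.1 hq)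
    · rintro rfl
      have := hB'.eq_of_mem hG hy hqk hyc hqc
      subst this
      exact hxy (right_mem_openSegment_iff.1 hq)
  by_cases hd : Disjoint (openSegment ℝ x y) (sites a b)
  · exact ⟨c, r, hB, x, hx, y, hy, hxc, hyc, hd⟩
  obtain ⟨q, hq, hqs⟩ := not_disjoint_iff.1 hd
  obtain ⟨k, hqk⟩ := mem_iUnion.1 hqs
  obtain ⟨hki, hkj⟩ := hself hB hx hy hxc hyc hq hqk
  have hxy : x ≠ y := by
    rintro rfl
    exact disjoint_left.1 (hS hij) hx hy
  have hqend := hB.mem_range_of_mem_openSegment hG hqk hxc hyc hxy hq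
  have hsph : segment ℝ x y ⊆ sphere c r := segment_subset_sphere hB.1 hxc hyc hq
    fun h => disjoint_left.1 (hB.disjoint k) hqk h
  have hqs' := openSegment_subset_segment ℝ _ _ hq
  -- `[x, y]` lies on the circle and `q` is an end point, hence `x` and `y` are not
  have hend : ∀ w ∈ segment ℝ x y, ∀ n, n ≠ k → w ∈ site a b n → w ∉ range a ∪ range b := by
    intro w hw n hn hwn hwend
    refine hG.2 w hwend q hqend ?_ c r (((convex_segment x y).segment_subset hw hqs').trans hsph)
    rintro rfl
    exact disjoint_left.1 (hS hn) hwn hqk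
  have hopen : ∀ w ∈ segment ℝ x y, ∀ n, n ≠ k → w ∈ site a b n →
      w ∈ openSegment ℝ (a n) (b n) ∧ a n ≠ b n := by
    intro w hw n hn hwn
    have h1 := hend w hw n hn hwn
    have h2 : w ∈ openSegment ℝ (a n) (b n) := mem_openSegment_of_ne_left_right
      (fun h => h1 (Or.inl ⟨n, h⟩)) (fun h => h1 (Or.inr ⟨n, h⟩)) hwn
    refine ⟨h2, fun h => h1 (Or.inr ⟨n, ?_⟩)⟩
    rw [h, openSegment_same] at h2
    exact h2.symm
  obtain ⟨hx', hai⟩ := hopen x (left_mem_segment ℝ _ _) i hki.symm hx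
  obtain ⟨hy', haj⟩ := hopen y (right_mem_segment ℝ _ _) j hkj.symm hy
  obtain ⟨c', r', hB', ⟨x', hx', hxc'⟩, ⟨y', hy', hyc'⟩, hother⟩ :=
    hB.exists_homothetic hG hij hki hkj hxy hx' hy' hai haj hxc hyc hq hqk
  refine ⟨c', r', hB', x', hx', y', hy', hxc', hyc', disjoint_left.2 fun w hw hws => ?_⟩
  obtain ⟨l, hl⟩ := mem_iUnion.1 hws
  obtain ⟨hli, hlj⟩ := hself hB' hx' hy' hxc' hyc' hw hl
  exact disjoint_left.1 (hother l hli hlj) hl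
    ((convex_closedBall _ _).segment_subset hxc' hyc' (openSegment_subset_segment ℝ _ _ hw))

/-- A disc that has points of two disjoint segments on its boundary, and whose interior meets no other
segment, contains an empty disc that touches both segments: its centre is a point
with equal distances to the segments on the path that two radii form between these points. -/
lemma exists_isEmptyDisc (hS : Pairwise fun i j => Disjoint (site a b i) (site a b j)) {i j : ι}
    (hij : i ≠ j) {v₁ v₂ c : Plane p} {r : ℝ} (h₁ : v₁ ∈ site a b i) (h₂ : v₂ ∈ site a b j)
    (hc₁ : dist v₁ c = r) (hc₂ : dist v₂ c = r)
    (hk : ∀ k, k ≠ i → k ≠ j → Disjoint (site a b k) (ball c r)) :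
    ∃ (c' : Plane p) (r' : ℝ), IsEmptyDisc a b c' r' ∧ (site a b i ∩ closedBall c' r').Nonempty ∧
      (site a b j ∩ closedBall c' r').Nonempty := by
  obtain ⟨f, hf⟩ : ∃ f : Plane p → ℝ, f = fun w => infDist w (site a b i) - infDist w (site a b j) :=
    ⟨_, rfl⟩
  have hfc : Continuous f := by
    rw [hf]; exact (continuous_infDist_pt _).sub (continuous_infDist_pt _)
  have hconn : IsPreconnected (segment ℝ v₁ c ∪ segment ℝ v₂ c) :=
    IsPreconnected.union c (right_mem_segment ℝ _ _) (right_mem_segment ℝ _ _)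
      (convex_segment _ _).isPreconnected (convex_segment _ _).isPreconnected
  have hf₁ : f v₁ ≤ 0 := by
    simp only [hf, infDist_zero_of_mem h₁]
    linarith [infDist_nonneg (x := v₁) (s := site a b j)]
  have hf₂ : 0 ≤ f v₂ := by
    simp only [hf, infDist_zero_of_mem h₂]
    linarith [infDist_nonneg (x := v₂) (s := site a b i)]
  obtain ⟨c', hc', hfc'⟩ := hconn.intermediate_value (Or.inl (left_mem_segment ℝ _ _))
    (Or.inr (left_mem_segment ℝ _ _)) hfc.continuousOn
    (show (0 : ℝ) ∈ Icc (f v₁) (f v₂) from ⟨hf₁, hf₂⟩)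
  have heq : infDist c' (site a b i) = infDist c' (site a b j) := by
    rw [hf] at hfc'; exact sub_eq_zero.1 hfc'
  obtain ⟨x, hx, hxd⟩ := (isCompact_site a b i).exists_infDist_eq_dist (site_nonempty a b i) c'
  obtain ⟨y, hy, hyd⟩ := (isCompact_site a b j).exists_infDist_eq_dist (site_nonempty a b j) c'
  have hle : infDist c' (site a b i) + dist c' c ≤ r := by
    rcases hc' with hc' | hc'
    · have h1 := dist_add_dist_of_mem_segment hc'
      have h2 := infDist_le_dist_of_mem (x := c') h₁
      rw [dist_comm c' v₁] at h2
      linarith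
    · have h1 := dist_add_dist_of_mem_segment hc'
      have h2 := infDist_le_dist_of_mem (x := c') h₂
      rw [dist_comm c' v₂] at h2
      linarith
  refine ⟨c', infDist c' (site a b i), ⟨?_, ?_⟩, ⟨x, hx, ?_⟩, ⟨y, hy, ?_⟩⟩
  · refine lt_of_le_of_ne infDist_nonneg fun h0 => ?_
    have hx0 : c' = x := dist_eq_zero.1 (by rw [← hxd, ← h0])
    have hy0 : c' = y := dist_eq_zero.1 (by rw [← hyd, ← heq, ← h0])
    exact disjoint_left.1 (hS hij) (hx0 ▸ hx) (hy0 ▸ hy)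
  · rw [disjoint_left]
    intro w hwc hw
    obtain ⟨k, hkw⟩ := mem_iUnion.1 hw
    by_cases hki : k = i
    · subst hki
      have := infDist_le_dist_of_mem (x := c') hkw
      rw [dist_comm] at this
      exact absurd hwc this.not_gt
    by_cases hkj : k = j
    · subst hkj
      have := infDist_le_dist_of_mem (x := c') hkw
      rw [dist_comm, ← heq] at this
      exact absurd hwc this.not_gt
    exact disjoint_left.1 (hk k hki hkj) hkw (ball_subset_ball' hle hwc)
  · rw [mem_closedBall, dist_comm, hxd]
  · rw [mem_closedBall, dist_comm, heq, hyd]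

end Unobstructed

/-! ### The Gabriel graph and Delaunay triangulations -/

section Delaunay

variable {p : ℝ≥0∞} [Fact (1 ≤ p)] {ι : Type*} {a b : ι → Plane p}

lemma GG_le_triangulationGraph [Finite ι] (κ : DiscKind) (hG : GeneralPosition a b)
    (hS : Pairwise fun i j => Disjoint (site a b i) (site a b j)) {T : Set (Set (Plane p))}
    (hT : ∀ f ∈ T, IsDelaunayFace a b f) : GG κ a b ≤ triangulationGraph a b T := by
  rintro i j ⟨hij, _, ⟨v₁, h₁, v₂, h₂, c₁, c₂, ⟨h12, hv₁, hv₂⟩, rfl⟩, hN⟩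
  have hc : c₁ = c₂ := by
    rw [sub_self, zero_mul] at h12
    exact dist_eq_zero.1 h12
  subst hc
  rw [show |(1 - 2) * dist v₁ v₂ / 2| = 1 * dist v₁ v₂ / 2 by
    rw [show (1 - 2) * dist v₁ v₂ / 2 = -(1 * dist v₁ v₂ / 2) by ring, abs_neg,
      abs_of_nonneg (by positivity)]] at hv₁ hv₂
  obtain ⟨c, r, hB, hi, hj⟩ := exists_isEmptyDisc hS hij h₁ h₂ hv₁ hv₂ fun k hki hkj => by
    rw [disjoint_left]
    intro w hw hwc
    have hw' := ball_subset_disc κ _ _ hwc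
    exact eq_empty_iff_forall_notMem.1 (hN k hki hkj) w ⟨⟨hw', hw'⟩, hw⟩
  obtain ⟨c', r', hB', x, hx, y, hy, hxc, hyc, hd⟩ :=
    hB.exists_disjoint_openSegment hG hS hij hi hj
  have hxy : x ≠ y := by
    rintro rfl
    exact disjoint_left.1 (hS hij) hx hy
  have hsub : openSegment ℝ x y ⊆ edgeRegion a b T := by
    intro w hw
    refine ⟨(convex_convexHull ℝ _).segment_subset
      (subset_convexHull ℝ _ (site_subset_sites i hx))
      (subset_convexHull ℝ _ (site_subset_sites j hy)) (openSegment_subset_segment ℝ _ _ hw), ?_⟩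
    rintro (⟨f, hf, hwf⟩ | hws)
    · exact disjoint_left.1 (hB'.disjoint_face hG hij hx hy hxc hyc hxy hd (hT f hf)) hw hwf
    · exact disjoint_left.1 hd hw hws
  have hmid : midpoint ℝ x y ∈ openSegment ℝ x y := by
    rw [openSegment_eq_image_lineMap]
    exact ⟨2⁻¹, by norm_num, by simp [midpoint]⟩
  exact ⟨hij, _, ⟨_, hsub hmid, rfl⟩, x, hx, y, hy,
    (convex_openSegment x y).isPreconnected.subset_connectedComponentIn hmid hsub⟩

end Delaunay

end SegSkeleton

theorem mainTheorem2 (p : ℝ≥0∞) [Fact (1 ≤ p)] {ι : Type*} [Fintype ι]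
    (a b : ι → SegSkeleton.Plane p)
    (β β' : ℝ) (hβ : 1 ≤ β) (hββ' : β ≤ β') (hβ' : β' ≤ 2) :
    (∀ M : SimpleGraph ι, SegSkeleton.IsMST a b M →
      M ≤ SegSkeleton.RNG SegSkeleton.DiscKind.isOpen a b) ∧
    (SegSkeleton.NoTies a b → ∀ M : SimpleGraph ι, SegSkeleton.IsMST a b M →
      M ≤ SegSkeleton.RNG SegSkeleton.DiscKind.isClosed a b) ∧
    (∀ κ : SegSkeleton.DiscKind,
      SegSkeleton.RNG κ a b ≤ SegSkeleton.skeleton κ a b β' ∧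
      SegSkeleton.skeleton κ a b β' ≤ SegSkeleton.skeleton κ a b β ∧
      SegSkeleton.skeleton κ a b β ≤ SegSkeleton.GG κ a b ∧
      (Pairwise (fun i j => Disjoint (SegSkeleton.site a b i) (SegSkeleton.site a b j)) →
        SegSkeleton.GeneralPosition a b →
        ∀ T : Set (Set (SegSkeleton.Plane p)),
          SegSkeleton.IsDelaunay a b T ∨ SegSkeleton.IsMaxDelaunayFamily a b T →
          SegSkeleton.GG κ a b ≤ SegSkeleton.triangulationGraph a b T)) := by
  refine ⟨fun M hM => hM.le_RNG_isOpen, fun hties M hM => hM.le_RNG_isClosed hties, fun κ =>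
    ⟨SegSkeleton.skeleton_le_skeleton κ a b (hβ.trans hββ') hβ' le_rfl,
      SegSkeleton.skeleton_le_skeleton κ a b hβ hββ' hβ',
      SegSkeleton.skeleton_le_skeleton κ a b le_rfl hβ (hββ'.trans hβ'), fun hS hG T hT => ?_⟩⟩
  exact SegSkeleton.GG_le_triangulationGraph κ hG hS (hT.elim (fun h => h.2) fun h => h.1)
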